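/- Let $K$ be a field, $S=K[x_1,\dots,x_n]$ with the standard grading, and let $M=\bigoplus_{k\in\mathbb Z}M_k$ be a finitely generated graded $S$-module with $M_k=0$ for $k<0$. Write $\beta_{i,j}(M)=\dim_K\operatorname{Tor}_i^S(M,K)_j$ for the graded Betti numbers of $M$. Let $L$ be the graded free $S$-module of rank $n$ with standard basis $\varepsilon_1,\dots,\varepsilon_n$ in degree $1$, and let $\mu:L\to S$ be the $S$-linear map with $\mu(\varepsilon_i)=x_i$. For an $S$-linear form $\nu:L\to S$ let $\partial_\nu$ denote the contraction by $\nu$ on $\bigwedge L\otimes_S M$, that is, $$\partial_\nu(v_1\wedge\dots\wedge v_i\otimes m)=\sum_{k=1}^i(-1)^{k-1}\nu(v_k)\,v_1\wedge\dots\wedge\widehat{v_k}\wedge\dots\wedge v_i\otimes m .$$ Let $K_i(n)_j$ be the component of $\bigwedge^i L\otimes_S M$ of internal degree $j$, let $\partial=\partial_\mu$ be the Koszul differential, and let $H_i(n)_j$ be the homology of $(K_\bullet(n),\partial)$ in homological degree $i$ and internal degree $j$. **Theorem 2.5.** Let $t\in\mathbb N=\{0,1,2,\dots\}$ and $1\le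 p\le n$. Suppose that $\beta_{p-1,\,p-1+l}(M)=0$ for $l=-1,0,\dots,t-1$ and that $\beta_{p,\,p+t}(M)\neq0$. Then there exist an $S$-basis $e_1,\dots,e_n$ of $L$ consisting of homogeneous elements of degree $1$ and a cycle $z\in K_p(n)_{p+t}$ such that, with $\partial_i=\partial_{e_i^*}$ for the dual basis $e_1^*,\dots,e_n^*$ of $\operatorname{Hom}_S(L,S)$, (i) the class $[z]\in H_p(n)_{p+t}$ is not zero; (ii) the elements $\partial_i(z)$, $i=1,\dots,p$, are cycles in $K_{p-1}(n)_{p-1+t}$, and their classes $[\partial_i(z)]\in H_{p-1}(n)_{p-1+t}$, $i=1,\dots,p$, are linearly independent over $K$. In particular, $\beta_{p-1,\,p-1+t}(M)\ge p$. -/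

import Mathlib

open scoped TensorProduct

universe u v

noncomputable section

namespace KoszulBetti

/-! ### The polynomial ring and its standard grading, indexed by the integers -/

/-- The `k`-th graded component of `K[x₁, …, xₙ]` for an integer `k` (zero when `k < 0`). -/
def polyGrading (K : Type u) [Field K] (n : ℕ) (k : ℤ) : Submodule K (MvPolynomial (Fin n) K) where
  carrier := {f | ∀ a : Fin n →₀ ℕ, f.coeff a ≠ 0 → (a.degree : ℤ) = k}
  zero_mem' := by intro a ha; simp at ha
  add_mem' := by
    intro f g hf hg a ha
    by_cases h : f.coeff a = 0
    · exact hg a (by simpa [h] using ha)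
    · exact hf a h
  smul_mem' := by
    intro c f hf a ha
    refine hf a fun h => ha ?_
    simp [h]

theorem mem_polyGrading {K : Type u} [Field K] {n : ℕ} {k : ℤ} {f : MvPolynomial (Fin n) K} :
    f ∈ polyGrading K n k ↔ ∀ a : Fin n →₀ ℕ, f.coeff a ≠ 0 → (a.degree : ℤ) = k := Iff.rfl

/-- In natural degrees this is Mathlib's grading by homogeneous polynomials. -/
theorem polyGrading_natCast (K : Type u) [Field K] (n d : ℕ) :
    polyGrading K n (d : ℤ) = MvPolynomial.homogeneousSubmodule (Fin n) K d := by
  ext f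
  rw [mem_polyGrading, MvPolynomial.mem_homogeneousSubmodule]
  unfold MvPolynomial.IsHomogeneous MvPolynomial.IsWeightedHomogeneous
  simp only [Finsupp.degree_eq_weight_one, Nat.cast_inj]
  rfl

/-- The graded free module with basis `ι`, the basis element `b` sitting in degree `deg b`:
the component of degree `k` of `⨁_b S(-deg b)`. -/
def freeGrading (K : Type u) [Field K] (n : ℕ) {ι : Type*} (deg : ι → ℤ) (k : ℤ) :
    Submodule K (ι →₀ MvPolynomial (Fin n) K) where
  carrier := {f | ∀ b, f b ∈ polyGrading K n (k - deg b)}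
  zero_mem' := fun _ => Submodule.zero_mem _
  add_mem' := fun hf hg b => Submodule.add_mem _ (hf b) (hg b)
  smul_mem' := fun c _ hf b => Submodule.smul_mem _ c (hf b)

/-! ### Graded free resolutions -/

section Resolution

variable {K : Type u} [Field K] {n : ℕ} {M : Type v} [AddCommGroup M] [Module K M]
  [Module (MvPolynomial (Fin n) K) M] [IsScalarTower K (MvPolynomial (Fin n) K) M]

/-- A graded free resolution `⋯ → F₁ → F₀ → M → 0` of the graded `S`-module `M`; here `Fᵢ` is
the free module on `ι i`, graded by the degrees `deg i` of its basis elements. -/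
structure GradedFreeResolution (𝓜 : ℤ → Submodule K M) where
  /-- the basis of the `i`-th module -/
  ι : ℕ → Type (max u v)
  /-- the degrees of the basis elements -/
  deg : ∀ i, ι i → ℤ
  /-- the differential `Fᵢ₊₁ → Fᵢ` -/
  d : ∀ i, (ι (i + 1) →₀ MvPolynomial (Fin n) K) →ₗ[MvPolynomial (Fin n) K]
    (ι i →₀ MvPolynomial (Fin n) K)
  /-- the augmentation `F₀ → M` -/
  ε : (ι 0 →₀ MvPolynomial (Fin n) K) →ₗ[MvPolynomial (Fin n) K] M
  d_mem : ∀ i k, ∀ f ∈ freeGrading K n (deg (i + 1)) k, d i f ∈ freeGrading K n (deg i) k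
  ε_mem : ∀ k, ∀ f ∈ freeGrading K n (deg 0) k, ε f ∈ 𝓜 k
  ε_surjective : Function.Surjective ε
  exact_zero : Function.Exact (d 0) ε
  exact_succ : ∀ i, Function.Exact (d (i + 1)) (d i)

/-! Existence of graded free resolutions. -/

theorem polyGrading_mul {i j : ℤ} {f g : MvPolynomial (Fin n) K}
    (hf : f ∈ polyGrading K n i) (hg : g ∈ polyGrading K n j) :
    f * g ∈ polyGrading K n (i + j) := by
  classical
  intro a ha
  rw [MvPolynomial.coeff_mul] at ha
  obtain ⟨x, hx, hne⟩ := Finset.exists_ne_zero_of_sum_ne_zero ha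
  have h1 := hf x.1 (left_ne_zero_of_mul hne)
  have h2 := hg x.2 (right_ne_zero_of_mul hne)
  rw [← Finset.HasAntidiagonal.mem_antidiagonal.1 hx, map_add]
  push_cast
  rw [h1, h2]

/-- A free module on homogeneous generators `v b` of degree `deg b` maps to the target by a
graded map. -/
theorem linearCombination_mem {ι : Type*} {deg : ι → ℤ} {𝓜 : ℤ → Submodule K M}
    [SetLike.GradedSMul (polyGrading K n) 𝓜] {x : ι → M} (hx : ∀ b, x b ∈ 𝓜 (deg b)) {k : ℤ}
    {f : ι →₀ MvPolynomial (Fin n) K} (hf : f ∈ freeGrading K n deg k) :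
    Finsupp.linearCombination (MvPolynomial (Fin n) K) x f ∈ 𝓜 k := by
  rw [Finsupp.linearCombination_apply]
  refine Submodule.sum_mem _ fun b _ => ?_
  have := SetLike.GradedSMul.smul_mem (A := polyGrading K n) (B := 𝓜) (hf b) (hx b)
  simpa using this

instance freeGrading_gradedSMul {ι : Type*} (deg : ι → ℤ) :
    SetLike.GradedSMul (polyGrading K n) (freeGrading K n deg) where
  smul_mem := by
    intro i j f g hf hg b
    have := polyGrading_mul hf (hg b)
    rw [Finsupp.smul_apply, smul_eq_mul, vadd_eq_add, add_sub_assoc]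
    exact this

theorem monomial_mem_freeGrading {ι : Type*} (deg : ι → ℤ) (b : ι) (a : Fin n →₀ ℕ) (c : K) :
    Finsupp.single b (MvPolynomial.monomial a c) ∈
      freeGrading K n deg ((a.degree : ℤ) + deg b) := by
  classical
  intro b' a' h
  by_cases hb : b = b'
  · subst hb
    rw [Finsupp.single_eq_same, MvPolynomial.coeff_monomial] at h
    by_cases ha : a = a'
    · subst ha; ring
    · simp [ha] at h
  · rw [Finsupp.single_eq_of_ne (Ne.symm hb)] at h
    simp at h

theorem iSup_freeGrading {ι : Type*} (deg : ι → ℤ) : ⨆ k, freeGrading K n deg k = ⊤ := by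
  rw [eq_top_iff]
  rintro f -
  induction f using Finsupp.induction_linear with
  | zero => exact Submodule.zero_mem _
  | add f g hf hg => exact Submodule.add_mem _ hf hg
  | single b q =>
    induction q using MvPolynomial.induction_on' with
    | monomial a c =>
      exact Submodule.mem_iSup_of_mem _ (monomial_mem_freeGrading deg b a c)
    | add q r hq hr =>
      rw [Finsupp.single_add]
      exact Submodule.add_mem _ hq hr

/-- If a sum of homogeneous elements of distinct degrees in a free module is zero, then so is
every summand. -/
theorem freeGrading_sum_eq_zero {ι : Type*} (deg : ι → ℤ) (s : Finset ℤ)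
    (g : ℤ → ι →₀ MvPolynomial (Fin n) K) (hg : ∀ k, g k ∈ freeGrading K n deg k)
    (h : ∑ k ∈ s, g k = 0) : ∀ k ∈ s, g k = 0 := by
  intro k hk
  ext b a
  by_contra hne
  have hne' : (g k b).coeff a ≠ 0 := by simpa using hne
  have hdeg := hg k b a hne'
  have h2 := congrArg (fun F : ι →₀ MvPolynomial (Fin n) K => (F b).coeff a) h
  simp only [Finsupp.finsetSum_apply, MvPolynomial.coeff_sum, Finsupp.zero_apply,
    MvPolynomial.coeff_zero] at h2
  rw [Finset.sum_eq_single_of_mem k hk] at h2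
  · exact hne' h2
  · intro j _ hjk
    by_contra h3
    have := hg j b a h3
    exact hjk (by omega)

/-- The property of a grading used for syzygies. -/
def SumsToZero {N : Type*} [AddCommGroup N] [Module K N] (𝓝 : ℤ → Submodule K N) : Prop :=
  ∀ (s : Finset ℤ) (g : ℤ → N), (∀ k, g k ∈ 𝓝 k) → ∑ k ∈ s, g k = 0 → ∀ k ∈ s, g k = 0

theorem sumsToZero_of_decomposition (𝓜 : ℤ → Submodule K M) [DirectSum.Decomposition 𝓜] :
    SumsToZero 𝓜 := by
  intro s g hg h k hk
  have h2 : ∑ j ∈ s, ((DirectSum.decompose 𝓜 (g j)) k : M) = 0 := by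
    have h3 := congrArg (fun y => ((DirectSum.decompose 𝓜 y) k : M)) h
    simp only [DirectSum.decompose_sum, DirectSum.decompose_zero, DirectSum.zero_apply,
      ZeroMemClass.coe_zero] at h3
    rw [← h3, DFinsupp.finsetSum_apply, AddSubmonoidClass.coe_finsetSum]
  rw [Finset.sum_eq_single_of_mem k hk] at h2
  · rwa [DirectSum.decompose_of_mem_same 𝓜 (hg k)] at h2
  · intro j _ hjk
    exact DirectSum.decompose_of_mem_ne 𝓜 (hg j) hjk

/-- The homogeneous syzygies of a family of vectors, as index set of the next free module. -/
abbrev Syz {ι : Type*} (deg : ι → ℤ) {N : Type*} [AddCommGroup N]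
    [Module (MvPolynomial (Fin n) K) N]
    (g : (ι →₀ MvPolynomial (Fin n) K) →ₗ[MvPolynomial (Fin n) K] N) :=
  Σ k : ℤ, {f : ι →₀ MvPolynomial (Fin n) K // f ∈ freeGrading K n deg k ∧ g f = 0}

/-- The map from the free module on the homogeneous syzygies. -/
abbrev syzMap {ι : Type*} (deg : ι → ℤ) {N : Type*} [AddCommGroup N]
    [Module (MvPolynomial (Fin n) K) N]
    (g : (ι →₀ MvPolynomial (Fin n) K) →ₗ[MvPolynomial (Fin n) K] N) :
    (Syz deg g →₀ MvPolynomial (Fin n) K) →ₗ[MvPolynomial (Fin n) K]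
      (ι →₀ MvPolynomial (Fin n) K) :=
  Finsupp.linearCombination _ fun b : Syz deg g => b.2.1

theorem syzMap_exact {ι : Type*} (deg : ι → ℤ) {N : Type*} [AddCommGroup N] [Module K N]
    [Module (MvPolynomial (Fin n) K) N] (𝓝 : ℤ → Submodule K N) (h𝓝 : SumsToZero 𝓝)
    (g : (ι →₀ MvPolynomial (Fin n) K) →ₗ[MvPolynomial (Fin n) K] N)
    (hg : ∀ k, ∀ f ∈ freeGrading K n deg k, g f ∈ 𝓝 k) :
    Function.Exact (syzMap deg g) g := by
  classical
  intro f
  constructor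
  · intro hf
    have hmem : f ∈ ⨆ k, freeGrading K n deg k := by
      rw [iSup_freeGrading]; exact Submodule.mem_top
    obtain ⟨c, hc⟩ := (Submodule.mem_iSup_iff_exists_dfinsupp _ f).1 hmem
    have hsum : f = ∑ k ∈ c.support, (c k : ι →₀ MvPolynomial (Fin n) K) := by
      rw [← hc]
      simp only [DFinsupp.lsum_apply_apply, DFinsupp.sumAddHom_apply, DFinsupp.sum]
      rfl
    have hz := h𝓝 c.support (fun k => g (c k)) (fun k => hg k _ (c k).2)
      (by rw [← map_sum, ← hsum, hf])
    rw [hsum]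
    change _ ∈ LinearMap.range (syzMap deg g)
    refine Submodule.sum_mem _ fun k hk => ?_
    refine ⟨Finsupp.single ⟨k, (c k : ι →₀ MvPolynomial (Fin n) K), (c k).2, hz k hk⟩ 1, ?_⟩
    simp [syzMap]
  · rintro ⟨y, rfl⟩
    rw [← LinearMap.comp_apply]
    suffices h : g ∘ₗ syzMap deg g = 0 by rw [h]; rfl
    ext b
    simpa [syzMap] using b.2.2.2

/-- One step of the construction: a free module together with the vectors its basis maps to. -/
structure Stage (K : Type u) [Field K] (n : ℕ) where
  /-- basis of the target -/
  ι₀ : Type (max u v)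
  /-- degrees in the target -/
  deg₀ : ι₀ → ℤ
  /-- basis of the source -/
  ι : Type (max u v)
  /-- degrees in the source -/
  deg : ι → ℤ
  /-- the map -/
  g : (ι →₀ MvPolynomial (Fin n) K) →ₗ[MvPolynomial (Fin n) K] (ι₀ →₀ MvPolynomial (Fin n) K)
  g_mem : ∀ k, ∀ f ∈ freeGrading K n deg k, g f ∈ freeGrading K n deg₀ k

/-- The next step. -/
def Stage.next (s : Stage.{u, v} K n) : Stage.{u, v} K n where
  ι₀ := s.ι
  deg₀ := s.deg
  ι := Syz s.deg s.g
  deg := fun b => b.1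
  g := syzMap s.deg s.g
  g_mem := fun _ _ hf => linearCombination_mem (𝓜 := freeGrading K n s.deg)
    (fun b => b.2.2.1) hf

/-- The iterated construction. -/
def Stage.iter (s : Stage.{u, v} K n) : ℕ → Stage.{u, v} K n
  | 0 => s
  | i + 1 => (Stage.iter s i).next

/-- Every graded module has a graded free resolution. -/
theorem GradedFreeResolution.nonempty (𝓜 : ℤ → Submodule K M) [DirectSum.Decomposition 𝓜]
    [SetLike.GradedSMul (polyGrading K n) 𝓜] :
    Nonempty (GradedFreeResolution (n := n) 𝓜) := by
  classical
  let B : Type (max u v) := ULift.{u} (Σ k : ℤ, 𝓜 k)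
  let degB : B → ℤ := fun b => b.down.1
  let ε : (B →₀ MvPolynomial (Fin n) K) →ₗ[MvPolynomial (Fin n) K] M :=
    Finsupp.linearCombination _ fun b : B => (b.down.2 : M)
  have hε : ∀ k, ∀ f ∈ freeGrading K n degB k, ε f ∈ 𝓜 k := fun k f hf =>
    linearCombination_mem (𝓜 := 𝓜) (fun b : B => b.down.2.2) hf
  let s : Stage.{u, v} K n :=
    { ι₀ := B, deg₀ := degB, ι := Syz degB ε, deg := fun b => b.1, g := syzMap degB ε
      g_mem := fun _ _ hf => linearCombination_mem (𝓜 := freeGrading K n degB)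
        (fun b => b.2.2.1) hf }
  refine ⟨{ ι := fun i => (s.iter i).ι₀
            deg := fun i => (s.iter i).deg₀
            d := fun i => (s.iter i).g
            ε := ε
            d_mem := fun i => (s.iter i).g_mem
            ε_mem := hε
            ε_surjective := ?_
            exact_zero := syzMap_exact degB 𝓜 (sumsToZero_of_decomposition 𝓜) ε hε
            exact_succ := fun i => syzMap_exact (s.iter i).deg (freeGrading K n (s.iter i).deg₀)
              (freeGrading_sum_eq_zero _) (s.iter i).g (s.iter i).g_mem }⟩
  intro m
  change m ∈ LinearMap.range ε
  rw [← DirectSum.sum_support_decompose 𝓜 m]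
  refine Submodule.sum_mem _ fun k _ =>
    ⟨Finsupp.single (ULift.up ⟨k, DirectSum.decompose 𝓜 m k⟩) 1, ?_⟩
  simp [ε]

/-! ### Graded Tor and graded Betti numbers -/

/-- The field `K` as a module over `S = K[x₁, …, xₙ]`, all variables acting as zero. -/
@[nolint unusedArguments]
def ResidueField (K : Type u) [Field K] (_n : ℕ) : Type u := K

instance : AddCommGroup (ResidueField K n) := inferInstanceAs (AddCommGroup K)

instance : Module K (ResidueField K n) := inferInstanceAs (Module K K)

instance : Module (MvPolynomial (Fin n) K) (ResidueField K n) :=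
  Module.compHom K (MvPolynomial.constantCoeff : MvPolynomial (Fin n) K →+* K)

theorem ResidueField.smul_def (f : MvPolynomial (Fin n) K) (x : ResidueField K n) :
    f • x = MvPolynomial.constantCoeff f • x := rfl

instance : IsScalarTower K (MvPolynomial (Fin n) K) (ResidueField K n) :=
  ⟨fun a f x => by simp [ResidueField.smul_def, mul_smul]⟩

variable (K n) in
/-- The generator `1` of `K`. -/
def ResidueField.one : ResidueField K n := (1 : K)

namespace GradedFreeResolution

variable {𝓜 : ℤ → Submodule K M} (F : GradedFreeResolution (n := n) 𝓜)

/-- The module `K ⊗_S Fᵢ`. -/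
abbrev Red (i : ℕ) : Type (max u v) :=
  ResidueField K n ⊗[MvPolynomial (Fin n) K] (F.ι i →₀ MvPolynomial (Fin n) K)

/-- The degree `j` component of `K ⊗_S Fᵢ` (with `K` concentrated in degree zero). -/
def redGrading (i : ℕ) (j : ℤ) : Submodule K (F.Red i) :=
  Submodule.span K {w | ∃ f ∈ freeGrading K n (F.deg i) j,
    w = ResidueField.one K n ⊗ₜ[MvPolynomial (Fin n) K] f}

/-- The differential `K ⊗_S Fᵢ₊₁ → K ⊗_S Fᵢ`, as a `K`-linear map. -/
def redD (i : ℕ) : F.Red (i + 1) →ₗ[K] F.Red i :=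
  ((F.d i).lTensor (ResidueField K n)).restrictScalars K

/-- The cycles of `K ⊗_S F` in homological degree `i` and internal degree `j`. -/
def torCycles : (i : ℕ) → ℤ → Submodule K (F.Red i)
  | 0, j => F.redGrading 0 j
  | i + 1, j => F.redGrading (i + 1) j ⊓ LinearMap.ker (F.redD i)

/-- The boundaries of `K ⊗_S F` in homological degree `i` and internal degree `j`. -/
def torBoundaries (i : ℕ) (j : ℤ) : Submodule K (F.Red i) :=
  (F.redGrading (i + 1) j).map (F.redD i)

/-- `Tor_i(M, K)_j`, the homology of `K ⊗_S F` computed from the graded free resolution `F` of `M`. -/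
abbrev Tor (i : ℕ) (j : ℤ) : Type (max u v) :=
  F.torCycles i j ⧸ (F.torBoundaries i j).submoduleOf (F.torCycles i j)

end GradedFreeResolution

/-- The graded Betti number `β_{i,j}(M) = dim_K Tor_i(M, K)_j`. -/
def betti (𝓜 : ℤ → Submodule K M) [DirectSum.Decomposition 𝓜]
    [SetLike.GradedSMul (polyGrading K n) 𝓜] (i : ℕ) (j : ℤ) : ℕ :=
  Module.finrank K
    ((Classical.choice (GradedFreeResolution.nonempty (n := n) 𝓜)).Tor i j)

end Resolution

/-! ### The Koszul complex -/

section Koszul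

/-- The free module `L` of rank `n`; its standard basis sits in degree one. -/
abbrev KoszulL (K : Type u) [Field K] (n : ℕ) : Type u := Fin n → MvPolynomial (Fin n) K

/-- The degree `k` component of `L`. -/
def koszulLGrading (K : Type u) [Field K] (n : ℕ) (k : ℤ) : Submodule K (KoszulL K n) where
  carrier := {w | ∀ j, w j ∈ polyGrading K n (k - 1)}
  zero_mem' := fun _ => Submodule.zero_mem _
  add_mem' := fun hf hg b => Submodule.add_mem _ (hf b) (hg b)
  smul_mem' := fun c _ hf b => Submodule.smul_mem _ c (hf b)

/-- The linear form `μ : L → S` that sends the `i`-th standard basis vector to `x_i`. -/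
def koszulForm (K : Type u) [Field K] (n : ℕ) :
    Module.Dual (MvPolynomial (Fin n) K) (KoszulL K n) :=
  Fintype.linearCombination (MvPolynomial (Fin n) K)
    (MvPolynomial.X : Fin n → MvPolynomial (Fin n) K)

variable {K : Type u} [Field K] {n : ℕ} {M : Type v} [AddCommGroup M] [Module K M]
  [Module (MvPolynomial (Fin n) K) M] [IsScalarTower K (MvPolynomial (Fin n) K) M]

variable (K n M) in
/-- The module `M ⊗_S ⋀ L` underlying the Koszul complex `K(n)`. -/
abbrev KoszulModule : Type (max u v) :=
  M ⊗[MvPolynomial (Fin n) K] ExteriorAlgebra (MvPolynomial (Fin n) K) (KoszulL K n)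

variable (M) in
/-- The contraction `id_M ⊗ ∂_ν` of `M ⊗_S ⋀ L` by a linear form `ν` on `L`, so that
`∂_ν (a ∧ b) = ν(a) b - a ∧ ∂_ν(b)` for `a ∈ L`. -/
def contraction (ν : Module.Dual (MvPolynomial (Fin n) K) (KoszulL K n)) :
    KoszulModule K n M →ₗ[K] KoszulModule K n M :=
  (LinearMap.lTensor M
    (CliffordAlgebra.contractLeft
      (Q := (0 : QuadraticForm (MvPolynomial (Fin n) K) (KoszulL K n))) ν)).restrictScalars K

/-- The component `K_p(n)_q` of homological degree `p` and internal degree `q`: it is spanned by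
the `m ⊗ (v₁ ∧ ⋯ ∧ v_p)` with `v_a` of degree one in `L` and `m` of degree `q - p` in `M`. -/
def koszulGrading (𝓜 : ℤ → Submodule K M) (p : ℕ) (q : ℤ) : Submodule K (KoszulModule K n M) :=
  Submodule.span K
    {w | ∃ x : Fin p → KoszulL K n, (∀ a, x a ∈ koszulLGrading K n 1) ∧ ∃ m ∈ 𝓜 (q - p),
      w = m ⊗ₜ[MvPolynomial (Fin n) K] ExteriorAlgebra.ιMulti (MvPolynomial (Fin n) K) p x}

/-- The Koszul cycles of bidegree `(p, q)`. -/
def koszulCycles (𝓜 : ℤ → Submodule K M) (p : ℕ) (q : ℤ) : Submodule K (KoszulModule K n M) :=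
  koszulGrading 𝓜 p q ⊓ LinearMap.ker (contraction M (koszulForm K n))

/-- The Koszul boundaries of bidegree `(p, q)`. -/
def koszulBoundaries (𝓜 : ℤ → Submodule K M) (p : ℕ) (q : ℤ) :
    Submodule K (KoszulModule K n M) :=
  (koszulGrading 𝓜 (p + 1) q).map (contraction M (koszulForm K n))

variable (n) in
/-- The Koszul homology `H_p(n)_q`. -/
abbrev KoszulHomology (𝓜 : ℤ → Submodule K M) (p : ℕ) (q : ℤ) : Type (max u v) :=
  koszulCycles (n := n) 𝓜 p q ⧸
    (koszulBoundaries (n := n) 𝓜 p q).submoduleOf (koszulCycles (n := n) 𝓜 p q)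

/-- The homology class `[z]` of a Koszul cycle `z` of bidegree `(p, q)`. -/
def koszulClass (𝓜 : ℤ → Submodule K M) (p : ℕ) (q : ℤ) (z : KoszulModule K n M)
    (hz : z ∈ koszulCycles 𝓜 p q) : KoszulHomology n 𝓜 p q :=
  Submodule.Quotient.mk ⟨z, hz⟩

end Koszul

end KoszulBetti

end

-- Betti numbers are dimensions of Koszul homology, so the theorem is about the Koszul complex.
-- Write `p + 1` for the homological degree of `z`, as the lemmas do, and `D` for the differential.
-- The heart is this: if `z` is a cycle of degree `p + 1` on the strand `t` and `∂_i z` is a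
-- boundary for all `i ≥ r`, counted from `0`, then `z` is homologous to an element of the head
-- complex `M ⊗ ⋀⟨e_0, …, e_{r-1}⟩`. For `r ≤ p` that complex is zero in degree `p + 1`
-- (`eq_zero_of_inHead`), so `z` is a boundary. Hence for `[z] ≠ 0` the `K`-linear map sending a
-- constant form `ν` to `[∂_ν z]` has rank at least `p + 1`. A basis of `Kⁿ` made of a complement of
-- its kernel followed by the kernel, read as a dual basis of `L`, gives the required `e`.
--
-- Elements are pushed into head complexes one basis vector at a time. An element of the head
-- complex on `e_0, …, e_m` splits as `a + e_m ∧ c` with `c = ∂_m w` and `a` free of `e_m`. If `c =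
-- D y` with `y` free of `e_m`, the summand `e_m ∧ c` can be traded for `μ(e_m) y` modulo the
-- boundary of `e_m ∧ y`. Such `y` exist because vanishing of the homology of degree `p` on the
-- strands below `t` passes from the full complex to all head complexes
-- (`exists_primitive_of_vanishing`), and on strand `t` a boundary lying in a head complex bounds
-- there (`exists_primitive_of_boundary`). These are the long exact sequences of the inclusions of
-- head complexes, carried out on elements.
--
-- The identification of Tor with Koszul homology (`betti_eq_finrank_koszulHomology`) walks along a
-- diagonal of the double complex formed by the Koszul complexes of the modules of a free
-- resolution. It needs exactness of the resolution in one direction and acyclicity of the Koszul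
-- complex of a free module in the other (`exists_koszulD_eq_of_kred_eq_zero`); the latter comes
-- from explicit homotopies that divide by one variable at a time.

universe w

set_option linter.unusedSectionVars false

noncomputable section

namespace KoszulBetti

section

variable {K : Type u} [Field K] {n : ℕ}

/-! ### The standard basis of the exterior algebra -/

variable (K n) in
/-- The basis of `⋀ L` given by the products of standard basis vectors. -/
def extBasis : Module.Basis (Finset (Fin n)) (MvPolynomial (Fin n) K)
    (ExteriorAlgebra (MvPolynomial (Fin n) K) (KoszulL K n)) :=
  (Pi.basisFun (MvPolynomial (Fin n) K) (Fin n)).ExteriorAlgebra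

variable (K n) in
/-- The standard basis vectors of `L` in the exterior algebra. -/
def extGen (i : Fin n) : ExteriorAlgebra (MvPolynomial (Fin n) K) (KoszulL K n) :=
  ExteriorAlgebra.ι _ (Pi.basisFun (MvPolynomial (Fin n) K) (Fin n) i)

theorem extBasis_singleton (i : Fin n) : extBasis K n {i} = extGen K n i := by
  rw [extBasis, ExteriorAlgebra.basis_apply_ofCard (n := 1) _ (Finset.card_singleton i)]
  rw [ExteriorAlgebra.ιMulti_family, ExteriorAlgebra.ιMulti_apply]
  simp only [List.ofFn_succ, List.ofFn_zero, List.prod_cons, List.prod_nil, mul_one, extGen,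
    Function.comp]
  congr 2
  -- The enumeration of `{i}` by `Fin 1` has `i` in its range, hence takes the value `i` at `0`.
  have h := (Set.powersetCard.mem_range_ofFinEmbEquiv_symm_iff_mem
    (Set.powersetCard.ofCard (Finset.card_singleton i)) i).2 (by
      rw [← Set.powersetCard.mem_coe_iff]; simp)
  obtain ⟨k, hk⟩ := h
  rw [Subsingleton.elim k 0] at hk
  exact hk

theorem extBasis_empty : extBasis K n ∅ = 1 := by
  rw [extBasis, ExteriorAlgebra.basis_apply_ofCard (n := 0) _ Finset.card_empty,
    ExteriorAlgebra.ιMulti_family, ExteriorAlgebra.ιMulti_zero_apply]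

theorem extGen_mul_of_mem {i : Fin n} {T : Finset (Fin n)} (h : i ∈ T) :
    extGen K n i * extBasis K n T = 0 := by
  rw [← extBasis_singleton]
  exact ExteriorAlgebra.basis_mul_of_not_disjoint _
    (Set.powersetCard.ofCard (Finset.card_singleton i)) (Set.powersetCard.ofCard rfl)
    (by simpa using h)

/-- The sign stays unspecified: later uses are memberships in subspaces, vanishing statements, or
equations with the same sign on both sides. -/
theorem extGen_mul_of_notMem {i : Fin n} {T : Finset (Fin n)} (h : i ∉ T) :
    ∃ s : ℤˣ, extGen K n i * extBasis K n T = s • extBasis K n (insert i T) := by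
  rw [← extBasis_singleton]
  have hd : Disjoint (Set.powersetCard.ofCard (Finset.card_singleton i)).val
    (Set.powersetCard.ofCard (s := T) rfl).val := by simpa using h
  have := ExteriorAlgebra.basis_mul_of_disjoint (Pi.basisFun (MvPolynomial (Fin n) K) (Fin n))
    (Set.powersetCard.ofCard (Finset.card_singleton i)) (Set.powersetCard.ofCard rfl) hd
  have hu : (Set.powersetCard.disjUnion hd).val = insert i T := by
    rw [Finset.insert_eq]
    exact Finset.disjUnion_eq_union _ _ hd
  rw [hu] at this
  exact ⟨_, this⟩

theorem extBasis_insert {i : Fin n} {T : Finset (Fin n)} (h : i ∉ T) :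
    ∃ s : ℤˣ, extBasis K n (insert i T) = s • (extGen K n i * extBasis K n T) := by
  obtain ⟨s, hs⟩ := extGen_mul_of_notMem (K := K) h
  exact ⟨s⁻¹, by rw [hs, inv_smul_smul]⟩

/-- Contraction of the exterior algebra by a linear form. -/
abbrev extContract (ν : Module.Dual (MvPolynomial (Fin n) K) (KoszulL K n)) :
    ExteriorAlgebra (MvPolynomial (Fin n) K) (KoszulL K n) →ₗ[MvPolynomial (Fin n) K]
    ExteriorAlgebra (MvPolynomial (Fin n) K) (KoszulL K n) :=
  CliffordAlgebra.contractLeft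
      (Q := (0 : QuadraticForm (MvPolynomial (Fin n) K) (KoszulL K n))) ν

variable (K n) in
/-- The standard dual basis vectors. -/
def stdCoord (i : Fin n) : Module.Dual (MvPolynomial (Fin n) K) (KoszulL K n) :=
  LinearMap.proj i

theorem extContract_ι_mul (ν : Module.Dual (MvPolynomial (Fin n) K) (KoszulL K n))
    (x : KoszulL K n) (y : ExteriorAlgebra (MvPolynomial (Fin n) K) (KoszulL K n)) :
    extContract ν (ExteriorAlgebra.ι _ x * y)
      = ν x • y - ExteriorAlgebra.ι _ x * extContract ν y :=
  CliffordAlgebra.contractLeft_ι_mul _ _ _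

theorem stdCoord_basis (i j : Fin n) :
    stdCoord K n i (Pi.basisFun (MvPolynomial (Fin n) K) (Fin n) j) = if i = j then 1 else 0 := by
  simp [stdCoord, Pi.single_apply]

theorem extContract_extGen_mul (i j : Fin n)
    (y : ExteriorAlgebra (MvPolynomial (Fin n) K) (KoszulL K n)) :
    extContract (stdCoord K n i) (extGen K n j * y)
      = (if i = j then y else 0) - extGen K n j * extContract (stdCoord K n i) y := by
  rw [extGen, extContract_ι_mul, stdCoord_basis]
  split_ifs <;> simp

theorem extContract_smul_unit (ν : Module.Dual (MvPolynomial (Fin n) K) (KoszulL K n)) (s : ℤˣ)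
    (y : ExteriorAlgebra (MvPolynomial (Fin n) K) (KoszulL K n)) :
    extContract ν (s • y) = s • extContract ν y := by
  rw [Units.smul_def, Units.smul_def, map_zsmul]

theorem extContract_of_notMem {i : Fin n} {T : Finset (Fin n)} (h : i ∉ T) :
    extContract (stdCoord K n i) (extBasis K n T) = 0 := by
  induction T using Finset.induction_on with
  | empty =>
    rw [extBasis_empty]
    exact CliffordAlgebra.contractLeft_one _ _
  | insert j T hj ih =>
    rw [Finset.mem_insert, not_or] at h
    obtain ⟨s, hs⟩ := extBasis_insert (K := K) hj
    rw [hs, extContract_smul_unit, extContract_extGen_mul, ih h.2, if_neg h.1]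
    simp

theorem extContract_insert {i : Fin n} {T : Finset (Fin n)} (h : i ∉ T) :
    ∃ s : ℤˣ, extContract (stdCoord K n i) (extBasis K n (insert i T)) = s • extBasis K n T := by
  obtain ⟨s, hs⟩ := extBasis_insert (K := K) h
  refine ⟨s, ?_⟩
  rw [hs, extContract_smul_unit, extContract_extGen_mul, extContract_of_notMem h, if_pos rfl]
  simp

theorem extContract_of_mem {i : Fin n} {T : Finset (Fin n)} (h : i ∈ T) :
    ∃ s : ℤˣ, extContract (stdCoord K n i) (extBasis K n T) = s • extBasis K n (T.erase i) := by
  simpa [Finset.insert_erase h] using extContract_insert (K := K) (Finset.notMem_erase i T)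

variable (K n) in
/-- The `K`-span of the standard basis vectors of `⋀^p L`. -/
def extConst (p : ℕ) : Submodule K (ExteriorAlgebra (MvPolynomial (Fin n) K) (KoszulL K n)) :=
  Submodule.span K (extBasis K n '' {T | T.card = p})

theorem extBasis_mem_extConst {T : Finset (Fin n)} {p : ℕ} (h : T.card = p) :
    extBasis K n T ∈ extConst K n p :=
  Submodule.subset_span ⟨T, h, rfl⟩

theorem unit_smul_mem {N : Type*} [AddCommGroup N] [Module K N] (P : Submodule K N) (s : ℤˣ)
    {x : N} (hx : x ∈ P) : s • x ∈ P := by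
  rw [Units.smul_def]
  exact P.toAddSubgroup.zsmul_mem hx _

theorem extGen_mul_mem_extConst (i : Fin n) {p : ℕ}
    {y : ExteriorAlgebra (MvPolynomial (Fin n) K) (KoszulL K n)} (hy : y ∈ extConst K n p) :
    extGen K n i * y ∈ extConst K n (p + 1) := by
  induction hy using Submodule.span_induction with
  | mem y hy =>
    obtain ⟨T, hT, rfl⟩ := hy
    by_cases h : i ∈ T
    · rw [extGen_mul_of_mem h]; exact Submodule.zero_mem _
    · obtain ⟨s, hs⟩ := extGen_mul_of_notMem (K := K) h
      rw [hs]
      exact unit_smul_mem _ _ (extBasis_mem_extConst (by rw [Finset.card_insert_of_notMem h, hT]))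
  | zero => rw [mul_zero]; exact Submodule.zero_mem _
  | add x y _ _ hx hy => rw [mul_add]; exact Submodule.add_mem _ hx hy
  | smul k x _ hx => rw [mul_smul_comm]; exact Submodule.smul_mem _ _ hx

theorem mem_polyGrading_zero {f : MvPolynomial (Fin n) K} (hf : f ∈ polyGrading K n 0) :
    f = MvPolynomial.C (MvPolynomial.constantCoeff f) := by
  ext a
  rw [MvPolynomial.coeff_C]
  split_ifs with h
  · rw [← h]; rfl
  · by_contra hne
    have := hf a hne
    rw [Nat.cast_eq_zero, Finsupp.degree_eq_zero_iff] at this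
    exact h this.symm

theorem eq_sum_of_mem_koszulLGrading {x : KoszulL K n} (hx : x ∈ koszulLGrading K n 1) :
    ∃ k : Fin n → K, x = ∑ i, k i • Pi.basisFun (MvPolynomial (Fin n) K) (Fin n) i := by
  refine ⟨fun i => MvPolynomial.constantCoeff (x i), ?_⟩
  ext1 j
  have := hx j
  rw [sub_self] at this
  rw [mem_polyGrading_zero this]
  simp [Finset.sum_apply, Pi.single_apply, MvPolynomial.smul_eq_C_mul]

theorem ιMulti_mem_extConst {p : ℕ} (x : Fin p → KoszulL K n)
    (hx : ∀ a, x a ∈ koszulLGrading K n 1) :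
    ExteriorAlgebra.ιMulti (MvPolynomial (Fin n) K) p x ∈ extConst K n p := by
  induction p with
  | zero =>
    rw [ExteriorAlgebra.ιMulti_zero_apply, ← extBasis_empty]
    exact extBasis_mem_extConst rfl
  | succ p ih =>
    rw [ExteriorAlgebra.ιMulti_succ_apply]
    obtain ⟨k, hk⟩ := eq_sum_of_mem_koszulLGrading (hx 0)
    rw [hk, map_sum, Finset.sum_mul]
    refine Submodule.sum_mem _ fun i _ => ?_
    rw [algebra_compatible_smul (MvPolynomial (Fin n) K) (k i), map_smul, smul_mul_assoc,
      ← algebra_compatible_smul]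
    exact Submodule.smul_mem _ _ (extGen_mul_mem_extConst i (ih _ fun a => hx _))

theorem basisFun_mem_koszulLGrading (i : Fin n) :
    Pi.basisFun (MvPolynomial (Fin n) K) (Fin n) i ∈ koszulLGrading K n 1 := by
  intro j a ha
  rw [Pi.basisFun_apply, Pi.single_apply] at ha
  split_ifs at ha with h
  · rw [MvPolynomial.coeff_one] at ha
    have : 0 = a := by by_contra h; simp [h] at ha
    simp [← this]
  · simp at ha

/-! ### Coordinates on the Koszul complex -/

section Coordinates

variable {M : Type v} [AddCommGroup M] [Module K M]
  [Module (MvPolynomial (Fin n) K) M] [IsScalarTower K (MvPolynomial (Fin n) K) M]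

/-- The coordinate of an element of `M ⊗ ⋀ L` at the basis vector indexed by `T`. -/
def kcoord (T : Finset (Fin n)) : KoszulModule K n M →ₗ[MvPolynomial (Fin n) K] M :=
  Finsupp.lapply T ∘ₗ (TensorProduct.equivFinsuppOfBasisRight (extBasis K n)).toLinearMap

theorem kcoord_tmul (T T' : Finset (Fin n)) (m : M) :
    kcoord T (m ⊗ₜ[MvPolynomial (Fin n) K] extBasis K n T') = if T' = T then m else 0 := by
  simp [kcoord, Finsupp.single_apply]

theorem kcoord_smul (T : Finset (Fin n)) (k : K) (w : KoszulModule K n M) :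
    kcoord T (k • w) = k • kcoord T w := by
  rw [algebra_compatible_smul (MvPolynomial (Fin n) K) k w, map_smul, ← algebra_compatible_smul]

theorem eq_sum_kcoord (w : KoszulModule K n M) :
    w = ∑ T, kcoord T w ⊗ₜ[MvPolynomial (Fin n) K] extBasis K n T := by
  apply (TensorProduct.equivFinsuppOfBasisRight (extBasis K n)).injective
  ext T
  change kcoord T w = kcoord T _
  rw [map_sum]
  simp [kcoord_tmul]

theorem kcoord_ext {w w' : KoszulModule K n M} (h : ∀ T, kcoord T w = kcoord T w') : w = w' := by
  rw [eq_sum_kcoord w, eq_sum_kcoord w']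
  simp only [h]

theorem tmul_extBasis_mem {𝓜 : ℤ → Submodule K M} {p : ℕ} {q : ℤ} {T : Finset (Fin n)}
    (hT : T.card = p) {m : M} (hm : m ∈ 𝓜 (q - p)) :
    m ⊗ₜ[MvPolynomial (Fin n) K] extBasis K n T ∈ koszulGrading 𝓜 p q := by
  rw [extBasis, ExteriorAlgebra.basis_apply_ofCard _ hT]
  exact Submodule.subset_span ⟨_, fun a => basisFun_mem_koszulLGrading _, m, hm, rfl⟩

/-- Degree-one vectors of `L` have constant coordinates, so a wedge of `p` of them is a
`K`-combination of standard basis vectors of `⋀^p L`. No polynomial coefficient shifts degree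
between the tensor factors, and membership can be tested on coordinates. -/
theorem mem_koszulGrading_iff {𝓜 : ℤ → Submodule K M} {p : ℕ} {q : ℤ} {w : KoszulModule K n M} :
    w ∈ koszulGrading 𝓜 p q ↔
      ∀ T, (T.card = p → kcoord T w ∈ 𝓜 (q - p)) ∧ (T.card ≠ p → kcoord T w = 0) := by
  constructor
  · intro hw T
    induction hw using Submodule.span_induction with
    | mem w hw =>
      obtain ⟨x, hx, m, hm, rfl⟩ := hw
      have := ιMulti_mem_extConst x hx
      generalize ExteriorAlgebra.ιMulti (MvPolynomial (Fin n) K) p x = y at this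
      induction this using Submodule.span_induction with
      | mem y hy =>
        obtain ⟨T', hT', rfl⟩ := hy
        rw [kcoord_tmul]
        constructor
        · intro h
          split_ifs
          · exact hm
          · exact Submodule.zero_mem _
        · intro h
          rw [if_neg]
          rintro rfl
          exact h hT'
      | zero => simp
      | add x y _ _ hx hy =>
        rw [TensorProduct.tmul_add, map_add]
        exact ⟨fun h => Submodule.add_mem _ (hx.1 h) (hy.1 h), fun h => by
          rw [hx.2 h, hy.2 h, add_zero]⟩
      | smul k x _ hx =>
        rw [TensorProduct.tmul_smul, kcoord_smul]
        exact ⟨fun h => Submodule.smul_mem _ _ (hx.1 h), fun h => by rw [hx.2 h, smul_zero]⟩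
    | zero => simp
    | add x y _ _ hx hy =>
      rw [map_add]
      exact ⟨fun h => Submodule.add_mem _ (hx.1 h) (hy.1 h), fun h => by
        rw [hx.2 h, hy.2 h, add_zero]⟩
    | smul k x _ hx =>
      rw [kcoord_smul]
      exact ⟨fun h => Submodule.smul_mem _ _ (hx.1 h), fun h => by rw [hx.2 h, smul_zero]⟩
  · intro h
    rw [eq_sum_kcoord w]
    refine Submodule.sum_mem _ fun T _ => ?_
    by_cases hT : T.card = p
    · exact tmul_extBasis_mem hT ((h T).1 hT)
    · rw [(h T).2 hT, TensorProduct.zero_tmul]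
      exact Submodule.zero_mem _

theorem koszulGrading_induction {𝓜 : ℤ → Submodule K M} {p : ℕ} {q : ℤ}
    {N : Type*} [AddCommGroup N] [Module K N] (φ : KoszulModule K n M →ₗ[K] N)
    (P : Submodule K N)
    (h : ∀ T : Finset (Fin n), T.card = p → ∀ m ∈ 𝓜 (q - p),
      φ (m ⊗ₜ[MvPolynomial (Fin n) K] extBasis K n T) ∈ P)
    {w : KoszulModule K n M} (hw : w ∈ koszulGrading 𝓜 p q) : φ w ∈ P := by
  rw [eq_sum_kcoord w, map_sum]
  refine Submodule.sum_mem _ fun T _ => ?_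
  by_cases hT : T.card = p
  · exact h T hT _ ((mem_koszulGrading_iff.1 hw T).1 hT)
  · rw [(mem_koszulGrading_iff.1 hw T).2 hT, TensorProduct.zero_tmul, map_zero]
    exact Submodule.zero_mem _

theorem koszulGrading_eq_bot {𝓜 : ℤ → Submodule K M} {p : ℕ} {q : ℤ} (h : n < p)
    {w : KoszulModule K n M} (hw : w ∈ koszulGrading 𝓜 p q) : w = 0 := by
  refine kcoord_ext fun T => ?_
  rw [map_zero, (mem_koszulGrading_iff.1 hw T).2]
  have := Finset.card_le_univ T
  rw [Fintype.card_fin] at this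
  omega

theorem koszulGrading_eq_zero_of_eq_bot {𝓜 : ℤ → Submodule K M} {p : ℕ} {q : ℤ}
    (h : 𝓜 (q - p) = ⊥) {w : KoszulModule K n M} (hw : w ∈ koszulGrading 𝓜 p q) : w = 0 := by
  refine kcoord_ext fun T => ?_
  rw [map_zero]
  by_cases hT : T.card = p
  · simpa [h] using (mem_koszulGrading_iff.1 hw T).1 hT
  · exact (mem_koszulGrading_iff.1 hw T).2 hT

theorem contraction_tmul (ν : Module.Dual (MvPolynomial (Fin n) K) (KoszulL K n)) (m : M)
    (y : ExteriorAlgebra (MvPolynomial (Fin n) K) (KoszulL K n)) :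
    contraction M ν (m ⊗ₜ[MvPolynomial (Fin n) K] y) =
      m ⊗ₜ[MvPolynomial (Fin n) K] extContract ν y := rfl

theorem dual_eq_sum (ν : Module.Dual (MvPolynomial (Fin n) K) (KoszulL K n)) :
    ν = ∑ i, ν (Pi.basisFun (MvPolynomial (Fin n) K) (Fin n) i) • stdCoord K n i := by
  refine (Pi.basisFun (MvPolynomial (Fin n) K) (Fin n)).ext fun j => ?_
  rw [LinearMap.sum_apply]
  simp only [LinearMap.smul_apply, stdCoord_basis, smul_eq_mul, mul_ite, mul_one, mul_zero]
  rw [Finset.sum_ite_eq']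
  simp

theorem tmul_unit_smul (m : M) (s : ℤˣ)
    (y : ExteriorAlgebra (MvPolynomial (Fin n) K) (KoszulL K n)) :
    m ⊗ₜ[MvPolynomial (Fin n) K] (s • y) = s • (m ⊗ₜ[MvPolynomial (Fin n) K] y) := by
  rw [Units.smul_def, Units.smul_def]
  exact map_zsmul (TensorProduct.mk (MvPolynomial (Fin n) K) M _ m) _ _

theorem contraction_tmul_eq_sum (ν : Module.Dual (MvPolynomial (Fin n) K) (KoszulL K n)) (m : M)
    (y : ExteriorAlgebra (MvPolynomial (Fin n) K) (KoszulL K n)) :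
    contraction M ν (m ⊗ₜ[MvPolynomial (Fin n) K] y) =
      ∑ i, (ν (Pi.basisFun (MvPolynomial (Fin n) K) (Fin n) i) • m)
        ⊗ₜ[MvPolynomial (Fin n) K] extContract (stdCoord K n i) y := by
  rw [contraction_tmul]
  conv_lhs => rw [dual_eq_sum ν]
  rw [extContract, map_sum, LinearMap.sum_apply, TensorProduct.tmul_sum]
  refine Finset.sum_congr rfl fun i _ => ?_
  rw [map_smul, LinearMap.smul_apply, TensorProduct.smul_tmul]

/-! ### Contractions and the bigrading -/

section Graded

variable {𝓜 : ℤ → Submodule K M} [SetLike.GradedSMul (polyGrading K n) 𝓜]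

theorem smul_mem_grading {d k : ℤ} {f : MvPolynomial (Fin n) K} (hf : f ∈ polyGrading K n d)
    {m : M} (hm : m ∈ 𝓜 k) : f • m ∈ 𝓜 (k + d) := by
  have := SetLike.GradedSMul.smul_mem (A := polyGrading K n) (B := 𝓜) hf hm
  rwa [vadd_eq_add, add_comm] at this

/-- Removing a vector of `L` costs internal degree one and its coefficient returns `d`. The case `d
= 1` is the Koszul differential, `d = 0` a contraction by a constant form. -/
theorem contraction_mem {ν : Module.Dual (MvPolynomial (Fin n) K) (KoszulL K n)} {d : ℤ}
    (hν : ∀ i, ν (Pi.basisFun (MvPolynomial (Fin n) K) (Fin n) i) ∈ polyGrading K n d)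
    {p : ℕ} {q : ℤ} {w : KoszulModule K n M} (hw : w ∈ koszulGrading 𝓜 (p + 1) q) :
    contraction M ν w ∈ koszulGrading 𝓜 p (q - 1 + d) := by
  refine koszulGrading_induction (contraction M ν) _ (fun T hT m hm => ?_) hw
  rw [contraction_tmul_eq_sum]
  refine Submodule.sum_mem _ fun i _ => ?_
  by_cases hi : i ∈ T
  · obtain ⟨s, hs⟩ := extContract_of_mem (K := K) hi
    rw [hs, tmul_unit_smul]
    refine unit_smul_mem _ _ (tmul_extBasis_mem (by rw [Finset.card_erase_of_mem hi, hT]; rfl) ?_)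
    have := smul_mem_grading (hν i) hm
    convert this using 2
    push_cast
    ring
  · rw [extContract_of_notMem hi, TensorProduct.tmul_zero]
    exact Submodule.zero_mem _

theorem contraction_eq_zero (ν : Module.Dual (MvPolynomial (Fin n) K) (KoszulL K n))
    {q : ℤ} {w : KoszulModule K n M} (hw : w ∈ koszulGrading 𝓜 0 q) :
    contraction M ν w = 0 := by
  refine (Submodule.mem_bot K).1 (koszulGrading_induction (contraction M ν) _
    (fun T hT m hm => ?_) hw)
  rw [Finset.card_eq_zero] at hT
  rw [contraction_tmul, hT, extBasis_empty, Submodule.mem_bot, extContract,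
    CliffordAlgebra.contractLeft_one, TensorProduct.tmul_zero]

theorem smul_mem_koszulGrading {d : ℤ} {f : MvPolynomial (Fin n) K} (hf : f ∈ polyGrading K n d)
    {p : ℕ} {q : ℤ} {w : KoszulModule K n M} (hw : w ∈ koszulGrading 𝓜 p q) :
    f • w ∈ koszulGrading 𝓜 p (q + d) := by
  rw [mem_koszulGrading_iff] at hw ⊢
  intro T
  rw [map_smul]
  refine ⟨fun h => ?_, fun h => by rw [(hw T).2 h, smul_zero]⟩
  convert smul_mem_grading hf ((hw T).1 h) using 2
  ring

end Graded

theorem X_mem_polyGrading (i : Fin n) :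
    (MvPolynomial.X i : MvPolynomial (Fin n) K) ∈ polyGrading K n 1 := by
  intro a ha
  rw [MvPolynomial.coeff_X] at ha
  have : Finsupp.single i 1 = a := by by_contra h; simp [h] at ha
  simp [← this]

theorem koszulForm_basis (i : Fin n) :
    koszulForm K n (Pi.basisFun (MvPolynomial (Fin n) K) (Fin n) i) = MvPolynomial.X i := by
  simp [koszulForm]

/-- The Koszul differential preserves the internal degree. -/
theorem koszulD_mem {𝓜 : ℤ → Submodule K M} [SetLike.GradedSMul (polyGrading K n) 𝓜]
    {p : ℕ} {q : ℤ} {w : KoszulModule K n M} (hw : w ∈ koszulGrading 𝓜 (p + 1) q) :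
    contraction M (koszulForm K n) w ∈ koszulGrading 𝓜 p q := by
  have := contraction_mem (d := 1) (fun i => by
    rw [koszulForm_basis]; exact X_mem_polyGrading i) hw
  rwa [sub_add_cancel] at this

theorem contraction_contraction (ν : Module.Dual (MvPolynomial (Fin n) K) (KoszulL K n))
    (w : KoszulModule K n M) : contraction M ν (contraction M ν w) = 0 := by
  induction w using TensorProduct.induction_on with
  | zero => simp
  | tmul m y =>
    rw [contraction_tmul, contraction_tmul, extContract, CliffordAlgebra.contractLeft_contractLeft,
      TensorProduct.tmul_zero]
  | add x y hx hy => rw [map_add, map_add, hx, hy, add_zero]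

/-- With `ν'` the Koszul form, this is why `∂_ν` preserves cycles and boundaries and acts on
homology. -/
theorem contraction_comm (ν ν' : Module.Dual (MvPolynomial (Fin n) K) (KoszulL K n))
    (w : KoszulModule K n M) :
    contraction M ν (contraction M ν' w) = - contraction M ν' (contraction M ν w) := by
  induction w using TensorProduct.induction_on with
  | zero => simp
  | tmul m y =>
    rw [contraction_tmul, contraction_tmul, contraction_tmul, contraction_tmul, extContract,
      extContract, CliffordAlgebra.contractLeft_comm, TensorProduct.tmul_neg]
  | add x y hx hy => rw [map_add, map_add, map_add, map_add, hx, hy, neg_add]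

theorem contraction_smul (ν : Module.Dual (MvPolynomial (Fin n) K) (KoszulL K n))
    (f : MvPolynomial (Fin n) K) (w : KoszulModule K n M) :
    contraction M ν (f • w) = f • contraction M ν w :=
  map_smul (LinearMap.lTensor M (extContract ν)) f w

variable (M) in
/-- Left multiplication by a vector of `L` on `M ⊗ ⋀ L`. -/
def wedge (x : KoszulL K n) : KoszulModule K n M →ₗ[K] KoszulModule K n M :=
  (LinearMap.lTensor M
    (LinearMap.mulLeft (MvPolynomial (Fin n) K) (ExteriorAlgebra.ι _ x))).restrictScalars K

theorem wedge_tmul (x : KoszulL K n) (m : M)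
    (y : ExteriorAlgebra (MvPolynomial (Fin n) K) (KoszulL K n)) :
    wedge M x (m ⊗ₜ[MvPolynomial (Fin n) K] y) =
      m ⊗ₜ[MvPolynomial (Fin n) K] (ExteriorAlgebra.ι _ x * y) := rfl

theorem contraction_wedge (ν : Module.Dual (MvPolynomial (Fin n) K) (KoszulL K n))
    (x : KoszulL K n) (w : KoszulModule K n M) :
    contraction M ν (wedge M x w) = ν x • w - wedge M x (contraction M ν w) := by
  induction w using TensorProduct.induction_on with
  | zero => simp
  | tmul m y =>
    rw [wedge_tmul, contraction_tmul, extContract_ι_mul, contraction_tmul, wedge_tmul,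
      TensorProduct.tmul_sub, TensorProduct.tmul_smul]
  | add x y hx hy => simp only [map_add, hx, hy, smul_add]; abel

theorem wedge_mem {𝓜 : ℤ → Submodule K M} {x : KoszulL K n} (hx : x ∈ koszulLGrading K n 1)
    {p : ℕ} {q : ℤ} {w : KoszulModule K n M} (hw : w ∈ koszulGrading 𝓜 p q) :
    wedge M x w ∈ koszulGrading 𝓜 (p + 1) (q + 1) := by
  induction hw using Submodule.span_induction with
  | mem w hw =>
    obtain ⟨y, hy, m, hm, rfl⟩ := hw
    refine Submodule.subset_span ⟨Fin.cons x y, ?_, m, ?_, ?_⟩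
    · intro a
      induction a using Fin.cases with
      | zero => exact hx
      | succ a => exact hy a
    · convert hm using 2
      push_cast
      ring
    · rw [wedge_tmul, ExteriorAlgebra.ιMulti_succ_apply]
      rfl
  | zero => simp
  | add x y _ _ hx hy => rw [map_add]; exact Submodule.add_mem _ hx hy
  | smul k x _ hx => rw [map_smul]; exact Submodule.smul_mem _ _ hx

end Coordinates

end

section

variable {K : Type u} [Field K] {n : ℕ}
variable {M : Type v} [AddCommGroup M] [Module K M]
  [Module (MvPolynomial (Fin n) K) M] [IsScalarTower K (MvPolynomial (Fin n) K) M]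

/-! ### Subcomplexes of the Koszul complex on part of a basis -/

/-- `w` lies in the Koszul subcomplex on `e₀, …, e_{m-1}`: the later contractions kill it. -/
def InHead (e : Module.Basis (Fin n) (MvPolynomial (Fin n) K) (KoszulL K n)) (m : ℕ)
    (w : KoszulModule K n M) : Prop :=
  ∀ i : Fin n, m ≤ i → contraction M (e.coord i) w = 0

/-- A basis of `L` that is homogeneous of degree one, together with its dual basis. -/
structure IsLinearBasis (e : Module.Basis (Fin n) (MvPolynomial (Fin n) K) (KoszulL K n)) :
    Prop where
  mem : ∀ i, e i ∈ koszulLGrading K n 1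
  coord_mem : ∀ i k, e.coord i (Pi.basisFun (MvPolynomial (Fin n) K) (Fin n) k) ∈
    polyGrading K n 0

theorem koszulForm_mem {x : KoszulL K n} (hx : x ∈ koszulLGrading K n 1) :
    koszulForm K n x ∈ polyGrading K n 1 := by
  rw [koszulForm, Fintype.linearCombination_apply]
  refine Submodule.sum_mem _ fun i _ => ?_
  have := polyGrading_mul (hx i) (X_mem_polyGrading i)
  simpa using this

variable {e : Module.Basis (Fin n) (MvPolynomial (Fin n) K) (KoszulL K n)}

theorem coord_basis (i j : Fin n) : e.coord i (e j) = if i = j then 1 else 0 := by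
  rw [Module.Basis.coord_apply, Module.Basis.repr_self, Finsupp.single_apply]
  simp only [eq_comm]

theorem contraction_wedge_self (i : Fin n) (w : KoszulModule K n M) :
    contraction M (e.coord i) (wedge M (e i) w) =
      w - wedge M (e i) (contraction M (e.coord i) w) := by
  rw [contraction_wedge, coord_basis, if_pos rfl, one_smul]

theorem contraction_wedge_of_ne {i j : Fin n} (h : i ≠ j) (w : KoszulModule K n M) :
    contraction M (e.coord i) (wedge M (e j) w) =
      - wedge M (e j) (contraction M (e.coord i) w) := by
  rw [contraction_wedge, coord_basis, if_neg h, zero_smul, zero_sub]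

theorem InHead.add {m : ℕ} {w w' : KoszulModule K n M} (h : InHead e m w) (h' : InHead e m w') :
    InHead e m (w + w') := fun i hi => by rw [map_add, h i hi, h' i hi, add_zero]

theorem InHead.smul {m : ℕ} {w : KoszulModule K n M} (h : InHead e m w)
    (f : MvPolynomial (Fin n) K) : InHead e m (f • w) := fun i hi => by
  rw [contraction_smul, h i hi, smul_zero]

theorem InHead.mono {m m' : ℕ} (hm : m ≤ m') {w : KoszulModule K n M} (h : InHead e m w) :
    InHead e m' w := fun i hi => h i (hm.trans hi)

theorem inHead_of_le {m : ℕ} (h : n ≤ m) (w : KoszulModule K n M) : InHead e m w :=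
  fun i hi => absurd i.2 (by omega)

theorem InHead.contraction_self {i : Fin n} {w : KoszulModule K n M} (h : InHead e (i + 1) w) :
    InHead e i (KoszulBetti.contraction M (e.coord i) w) := by
  intro j hj
  by_cases hij : j = i
  · rw [hij, contraction_contraction]
  · have : (j : ℕ) ≠ i := fun h => hij (Fin.ext h)
    rw [contraction_comm, h j (by omega), map_zero, neg_zero]

theorem InHead.wedge {i : Fin n} {m : ℕ} (hm : i < m) {w : KoszulModule K n M}
    (h : InHead e m w) : InHead e m (wedge M (e i) w) := by
  intro j hj
  have : j ≠ i := by rintro rfl; omega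
  rw [contraction_wedge_of_ne this, h j hj, map_zero, neg_zero]

/-- `∂_i(e_i ∧ w) = w - e_i ∧ ∂_i w` is the part of `w` not involving `e_i`. -/
theorem inHead_contraction_wedge {i : Fin n} {w : KoszulModule K n M} (h : InHead e (i + 1) w) :
    InHead e i (contraction M (e.coord i) (wedge M (e i) w)) :=
  (h.wedge (Nat.lt_succ_self _)).contraction_self

variable {𝓜 : ℤ → Submodule K M} [SetLike.GradedSMul (polyGrading K n) 𝓜]

theorem IsLinearBasis.contraction_mem (he : IsLinearBasis e) (i : Fin n) {p : ℕ} {q : ℤ}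
    {w : KoszulModule K n M} (hw : w ∈ koszulGrading 𝓜 (p + 1) q) :
    contraction M (e.coord i) w ∈ koszulGrading 𝓜 p (q - 1) := by
  have := KoszulBetti.contraction_mem (he.coord_mem i) hw
  rwa [add_zero] at this

/-- The exterior algebra on `m` vectors has nothing in degree `p > m`. Wedging with `e_m` raises `p`
and `m` together until the degree exceeds `n`; contracting by `e_m^*` then recovers `w` from `e_m ∧
w = 0`. No basis of `⋀ L` adapted to `e` is needed. -/
theorem eq_zero_of_inHead (he : IsLinearBasis e) {m p : ℕ} (hm : m < p) {q : ℤ}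
    {w : KoszulModule K n M} (hw : w ∈ koszulGrading 𝓜 p q) (h : InHead e m w) : w = 0 := by
  by_cases hn : n < p
  · exact koszulGrading_eq_bot hn hw
  · have hmn : m < n := by omega
    have h1 : wedge M (e ⟨m, hmn⟩) w = 0 :=
      eq_zero_of_inHead he (m := m + 1) (p := p + 1) (by omega) (wedge_mem (he.mem _) hw)
        ((h.mono (Nat.le_succ m)).wedge (i := ⟨m, hmn⟩) (Nat.lt_succ_self m))
    have h2 := contraction_wedge_self (e := e) ⟨m, hmn⟩ w
    rw [h1, h ⟨m, hmn⟩ le_rfl, map_zero, map_zero, sub_zero] at h2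
    exact h2.symm
termination_by n + 1 - p

/-- Pushing a primitive of an element of the head complex from one head complex to the
previous one. -/
theorem exists_primitive_step (he : IsLinearBasis e) (i : Fin n) {p : ℕ} {q : ℤ}
    (H : ∀ y ∈ koszulCycles 𝓜 p (q - 1), InHead e i y →
      ∃ y' ∈ koszulGrading 𝓜 (p + 1) (q - 1), InHead e i y' ∧
        contraction M (koszulForm K n) y' = y)
    {w' : KoszulModule K n M} (hw' : w' ∈ koszulGrading 𝓜 (p + 1) q) (h' : InHead e (i + 1) w')
    (h : InHead e i (contraction M (koszulForm K n) w')) :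
    ∃ w'' ∈ koszulGrading 𝓜 (p + 1) q, InHead e i w'' ∧
      contraction M (koszulForm K n) w'' = contraction M (koszulForm K n) w' := by
  have hc : contraction M (e.coord i) w' ∈ koszulGrading 𝓜 p (q - 1) := he.contraction_mem i hw'
  have hDc : contraction M (koszulForm K n) (contraction M (e.coord i) w') = 0 := by
    rw [contraction_comm, h i le_rfl, neg_zero]
  obtain ⟨y, hy, hyh, hDy⟩ := H _ ⟨hc, hDc⟩ h'.contraction_self
  -- Split `w' = a + e_i ∧ c` with `a = ∂_i(e_i ∧ w')` and `c = ∂_i w' = D y`. Since `D c = 0`, `D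
  -- w' = D a + μ(e_i) c = D(a + μ(e_i) y)`, and neither summand involves `e_i`.
  refine ⟨contraction M (e.coord i) (wedge M (e i) w') + koszulForm K n (e i) • y, ?_, ?_, ?_⟩
  · refine Submodule.add_mem _ ?_ ?_
    · have := he.contraction_mem i (wedge_mem (he.mem i) hw')
      rwa [add_sub_cancel_right] at this
    · have := smul_mem_koszulGrading (koszulForm_mem (he.mem i)) hy
      rwa [sub_add_cancel] at this
  · exact (inHead_contraction_wedge h').add (hyh.smul _)
  · rw [map_add, contraction_comm, contraction_wedge, map_sub, contraction_smul,
      contraction_wedge_self, h i le_rfl, map_zero, contraction_smul, hDy]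
    abel

/-- If the Koszul homology of `M` vanishes in homological degree `p` and internal degrees less
than `q`, then so does that of each of the head complexes. -/
theorem exists_primitive_of_vanishing (he : IsLinearBasis e) (hM : ∀ k : ℤ, k < 0 → 𝓜 k = ⊥)
    {p : ℕ} {t : ℕ} (H : ∀ l : ℕ, l < t → koszulCycles (n := n) 𝓜 p (p + l) ≤
      koszulBoundaries 𝓜 p (p + l)) (m : ℕ) (l : ℤ) (hl : l < t) :
    ∀ w ∈ koszulCycles 𝓜 p ((p : ℤ) + l), InHead e m w →
      ∃ w' ∈ koszulGrading 𝓜 (p + 1) ((p : ℤ) + l), InHead e m w' ∧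
        contraction M (koszulForm K n) w' = w := by
  -- Double induction: upwards in `l`, starting from the vanishing of `M` in negative degrees, and
  -- for fixed `l` downwards in `m` from the full complex.
  by_cases hl0 : l < 0
  · intro w hw _
    have : w = 0 := koszulGrading_eq_zero_of_eq_bot (hM _ (by omega)) hw.1
    exact ⟨0, Submodule.zero_mem _, fun i _ => map_zero _, by rw [this, map_zero]⟩
  by_cases hm : n ≤ m
  · lift l to ℕ using by omega
    intro w hw _
    obtain ⟨w', hw', rfl⟩ := H l (by omega) hw
    exact ⟨w', hw', inHead_of_le hm _, rfl⟩
  · intro w hw hh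
    obtain ⟨w', hw', hh', rfl⟩ := exists_primitive_of_vanishing he hM H (m + 1) l hl w hw
      (hh.mono (Nat.le_succ m))
    refine exists_primitive_step he ⟨m, by omega⟩ ?_ hw' hh' hh
    -- Contraction by `e_m^*` lowers the internal degree by one, so the step needs the same head
    -- complex on the preceding strand.
    have := exists_primitive_of_vanishing he hM H m (l - 1) (by omega)
    rwa [← add_sub_assoc] at this
-- The shift by one makes the descent from `l = 0` to `l = -1` strict.
termination_by ((l + 1).toNat, n - m)
decreasing_by
  · exact Prod.Lex.right _ (by omega)
  · exact Prod.Lex.left _ _ (by omega)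

/-- A boundary that lies in a head complex is a boundary in the head complex. -/
theorem exists_primitive_of_boundary (he : IsLinearBasis e) (hM : ∀ k : ℤ, k < 0 → 𝓜 k = ⊥)
    {p : ℕ} {t : ℕ} (H : ∀ l : ℕ, l < t → koszulCycles (n := n) 𝓜 p (p + l) ≤
      koszulBoundaries 𝓜 p (p + l)) (m : ℕ) :
    ∀ w ∈ koszulBoundaries 𝓜 p ((p : ℤ) + t), InHead e m w →
      ∃ w' ∈ koszulGrading 𝓜 (p + 1) ((p : ℤ) + t), InHead e m w' ∧
        contraction M (koszulForm K n) w' = w := by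
  by_cases hm : n ≤ m
  · rintro w ⟨w', hw', rfl⟩ _
    exact ⟨w', hw', inHead_of_le hm _, rfl⟩
  · intro w hw hh
    obtain ⟨w', hw', hh', rfl⟩ := exists_primitive_of_boundary he hM H (m + 1) w hw
      (hh.mono (Nat.le_succ m))
    refine exists_primitive_step he ⟨m, by omega⟩ ?_ hw' hh' hh
    -- Only strand `t - 1` enters; on strand `t` itself the homology need not vanish.
    have := exists_primitive_of_vanishing he hM H m (t - 1) (by omega)
    rwa [← add_sub_assoc] at this
termination_by n - m

/-- A cycle all of whose contractions by `e_i^*`, `i ≥ r`, are boundaries is homologous to an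
element of the head complex on `e₀, …, e_{r-1}`. -/
theorem exists_homologous_inHead (he : IsLinearBasis e) (hM : ∀ k : ℤ, k < 0 → 𝓜 k = ⊥)
    {p : ℕ} {t : ℕ} (H : ∀ l : ℕ, l < t → koszulCycles (n := n) 𝓜 p (p + l) ≤
      koszulBoundaries 𝓜 p (p + l)) {q : ℤ} (hq : q = p + t + 1)
    {z : KoszulModule K n M} (hz : z ∈ koszulGrading 𝓜 (p + 1) q) (m : ℕ)
    (hb : ∀ i : Fin n, m ≤ i →
      contraction M (e.coord i) z ∈ koszulBoundaries 𝓜 p ((p : ℤ) + t)) :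
    ∃ z' ∈ koszulGrading 𝓜 (p + 1) q, InHead e m z' ∧
      z - z' ∈ koszulBoundaries 𝓜 (p + 1) q := by
  by_cases hm : n ≤ m
  · exact ⟨z, hz, inHead_of_le hm _, by rw [sub_self]; exact Submodule.zero_mem _⟩
  · obtain ⟨z', hz', hh, y, hy, hyz⟩ := exists_homologous_inHead he hM H hq hz (m + 1)
      fun i hi => hb i (by omega)
    let i : Fin n := ⟨m, by omega⟩
    -- The hypothesis concerns `z`, but `z - z' = D y` and `∂_i D = -D ∂_i`, so it passes to `z'`.
    have hcb : contraction M (e.coord i) z' ∈ koszulBoundaries 𝓜 p ((p : ℤ) + t) := by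
      have h1 : contraction M (e.coord i) z' = contraction M (e.coord i) z +
          contraction M (koszulForm K n) (contraction M (e.coord i) y) := by
        rw [contraction_comm (koszulForm K n), hyz, map_sub]
        abel
      rw [h1]
      refine Submodule.add_mem _ (hb i le_rfl) ⟨_, ?_, rfl⟩
      have := he.contraction_mem i hy
      rwa [hq, add_sub_cancel_right] at this
    obtain ⟨x, hx, hxh, hDx⟩ := exists_primitive_of_boundary he hM H m _ hcb
      (InHead.contraction_self (i := i) hh)
    have hw : wedge M (e i) x ∈ koszulGrading 𝓜 (p + 1 + 1) q := by
      rw [hq]; exact wedge_mem (he.mem i) hx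
    -- As `D x = ∂_i z'`, adding `D(e_i ∧ x) = μ(e_i) x - e_i ∧ D x` cancels exactly the part of
    -- `z'` that involves `e_i`.
    have hz'' : z' + contraction M (koszulForm K n) (wedge M (e i) x) =
        contraction M (e.coord i) (wedge M (e i) z') + koszulForm K n (e i) • x := by
      rw [contraction_wedge, hDx, contraction_wedge_self]
      abel
    refine ⟨z' + contraction M (koszulForm K n) (wedge M (e i) x),
      Submodule.add_mem _ hz' (koszulD_mem hw), ?_, ?_⟩
    · rw [hz'']
      exact (inHead_contraction_wedge (i := i) hh).add (hxh.smul _)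
    · refine ⟨y - wedge M (e i) x, Submodule.sub_mem _ hy hw, ?_⟩
      rw [map_sub, hyz]
      abel
termination_by n - m

/-- If fewer than `p + 1` contractions of a cycle `z` by a dual basis are non-zero in homology,
then `z` is a boundary. -/
theorem mem_koszulBoundaries_of_contractions (he : IsLinearBasis e)
    (hM : ∀ k : ℤ, k < 0 → 𝓜 k = ⊥)
    {p : ℕ} {t : ℕ} (H : ∀ l : ℕ, l < t → koszulCycles (n := n) 𝓜 p (p + l) ≤
      koszulBoundaries 𝓜 p (p + l)) {q : ℤ} (hq : q = p + t + 1)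
    {z : KoszulModule K n M} (hz : z ∈ koszulGrading 𝓜 (p + 1) q) {r : ℕ} (hr : r < p + 1)
    (hb : ∀ i : Fin n, r ≤ i →
      contraction M (e.coord i) z ∈ koszulBoundaries 𝓜 p ((p : ℤ) + t)) :
    z ∈ koszulBoundaries 𝓜 (p + 1) q := by
  obtain ⟨z', hz', hh, hb⟩ := exists_homologous_inHead he hM H hq hz r hb
  rwa [eq_zero_of_inHead he hr hz' hh, sub_zero] at hb

/-! ### Bases adapted to a linear map -/

/-- A basis of a complement of the kernel comes first, a basis of the kernel last; `θ` is injective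
on the complement, and `r` is its rank. It is applied to `θ(ν) = [∂_ν z]`. -/
theorem exists_adapted_basis {H : Type*} [AddCommGroup H] [Module K H]
    (θ : (Fin n → K) →ₗ[K] H) :
    ∃ (f : Module.Basis (Fin n) K (Fin n → K)) (r : ℕ) (hr : r ≤ n),
      (∀ i : Fin n, r ≤ i → θ (f i) = 0) ∧
      LinearIndependent K fun i : Fin r => θ (f (Fin.castLE hr i)) := by
  obtain ⟨C, hC⟩ := Submodule.exists_isCompl (LinearMap.ker θ)
  let bC := Module.finBasis K C
  let bk := Module.finBasis K (LinearMap.ker θ)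
  let b := (bC.prod bk).map (Submodule.prodEquivOfIsCompl C (LinearMap.ker θ) hC.symm)
  have hn : Module.finrank K C + Module.finrank K (LinearMap.ker θ) = n := by
    have := Submodule.finrank_add_eq_of_isCompl hC.symm
    rwa [Module.finrank_fin_fun] at this
  let f := b.reindex (finSumFinEquiv.trans (finCongr hn))
  refine ⟨f, Module.finrank K C, by omega, ?_, ?_⟩
  · intro i hi
    obtain ⟨x, rfl⟩ := (finSumFinEquiv.trans (finCongr hn)).surjective i
    rcases x with j | j
    · simp at hi
      omega
    · simp [f, b]
  · have : (fun i : Fin (Module.finrank K C) => θ (f (Fin.castLE (by omega) i))) =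
        (θ ∘ₗ C.subtype) ∘ bC := by
      ext1 i
      have h2 : Fin.castLE (by omega) i = finSumFinEquiv.trans (finCongr hn) (Sum.inl i) := by
        ext; simp
      simp only [f]
      rw [h2, Module.Basis.reindex_apply, Equiv.symm_apply_apply]
      simp [b]
    rw [this]
    refine bC.linearIndependent.map' _ ?_
    rw [LinearMap.ker_comp, ← Submodule.disjoint_iff_comap_eq_bot]
    exact hC.disjoint.symm

/-- The constant linear form on `L` with the given coefficients. -/
def constForm (k : Fin n → K) : Module.Dual (MvPolynomial (Fin n) K) (KoszulL K n) :=
  ∑ i, k i • stdCoord K n i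

theorem constForm_basis (k : Fin n → K) (i : Fin n) :
    constForm k (Pi.basisFun (MvPolynomial (Fin n) K) (Fin n) i) = MvPolynomial.C (k i) := by
  rw [constForm, LinearMap.sum_apply]
  simp only [LinearMap.smul_apply, stdCoord_basis, smul_ite, smul_zero]
  rw [Finset.sum_ite_eq' Finset.univ i, if_pos (Finset.mem_univ i), MvPolynomial.smul_eq_C_mul,
    mul_one]

theorem C_mem_polyGrading (k : K) : (MvPolynomial.C k : MvPolynomial (Fin n) K) ∈
    polyGrading K n 0 := by
  intro a ha
  rw [MvPolynomial.coeff_C] at ha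
  have : 0 = a := by by_contra h; simp [h] at ha
  simp [← this]

/-- Every basis of `Kⁿ` is the basis of constant linear forms dual to a homogeneous basis
of `L`. -/
theorem exists_isLinearBasis (f : Module.Basis (Fin n) K (Fin n → K)) :
    ∃ e : Module.Basis (Fin n) (MvPolynomial (Fin n) K) (KoszulL K n),
      IsLinearBasis e ∧ ∀ i, e.coord i = constForm (f i) := by
  classical
  let A : Matrix (Fin n) (Fin n) K := Matrix.of fun i j => f i j
  have hA : IsUnit A.det := by
    have := (Pi.basisFun K (Fin n)).isUnit_det f
    have h2 : (Pi.basisFun K (Fin n)).det f = A.det := by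
      rw [Module.Basis.det_apply, ← Matrix.det_transpose A]
      congr 1
    rwa [h2] at this
  -- The rows of `A` are the prescribed coordinate forms, so the basis of `L` consists of the
  -- columns of `A⁻¹`; both have constant entries.
  let B := A⁻¹
  have hAB : A * B = 1 := Matrix.mul_nonsing_inv A hA
  have hBA : B * A = 1 := Matrix.nonsing_inv_mul A hA
  let c : K →+* MvPolynomial (Fin n) K := MvPolynomial.C
  have hAB' : A.map c * B.map c = 1 := by
    rw [← Matrix.map_mul, hAB, Matrix.map_one _ c.map_zero c.map_one]
  have hBA' : B.map c * A.map c = 1 := by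
    rw [← Matrix.map_mul, hBA, Matrix.map_one _ c.map_zero c.map_one]
  let eq : KoszulL K n ≃ₗ[MvPolynomial (Fin n) K] (Fin n → MvPolynomial (Fin n) K) :=
    LinearEquiv.ofLinearMap (Matrix.mulVecLin (A.map c)) (Matrix.mulVecLin (B.map c))
      (by rw [← Matrix.mulVecLin_mul, hAB', Matrix.mulVecLin_one])
      (by rw [← Matrix.mulVecLin_mul, hBA', Matrix.mulVecLin_one])
  let e := Module.Basis.ofEquivFun eq
  have hcoord : ∀ i, e.coord i = constForm (f i) := by
    intro i
    refine (Pi.basisFun (MvPolynomial (Fin n) K) (Fin n)).ext fun j => ?_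
    rw [constForm_basis, Module.Basis.coord_apply]
    simp [e, eq, A, c]
  refine ⟨e, ⟨fun i j => ?_, fun i k => ?_⟩, hcoord⟩
  · have : e i j = MvPolynomial.C (B j i) := by
      simp [e, eq, c, Module.Basis.coe_ofEquivFun]
    rw [this, sub_self]
    exact C_mem_polyGrading _
  · rw [hcoord, constForm_basis]
    exact C_mem_polyGrading _

end

section

/-! ### Comparing subquotients along a linear relation -/

/-- A zigzag step relates cycles without being a map between them. The part of `R` inside `A × B`
surjects onto both subquotients by `h₁` and `h₂`, with equal kernels by `h₃`. -/
theorem nonempty_quotient_equiv_of_relation {K X Y : Type*} [Field K] [AddCommGroup X] [Module K X]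
    [AddCommGroup Y] [Module K Y] (A A₀ : Submodule K X) (B B₀ : Submodule K Y)
    (R : Submodule K (X × Y)) (h₁ : ∀ x ∈ A, ∃ y ∈ B, (x, y) ∈ R)
    (h₂ : ∀ y ∈ B, ∃ x ∈ A, (x, y) ∈ R)
    (h₃ : ∀ x ∈ A, ∀ y ∈ B, (x, y) ∈ R → (x ∈ A₀ ↔ y ∈ B₀)) :
    Nonempty ((A ⧸ A₀.submoduleOf A) ≃ₗ[K] (B ⧸ B₀.submoduleOf B)) := by
  let P : Submodule K (X × Y) := R ⊓ A.prod B
  let fA : P →ₗ[K] A := (LinearMap.fst K X Y ∘ₗ P.subtype).codRestrict A fun x => x.2.2.1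
  let fB : P →ₗ[K] B := (LinearMap.snd K X Y ∘ₗ P.subtype).codRestrict B fun x => x.2.2.2
  let gA := (A₀.submoduleOf A).mkQ ∘ₗ fA
  let gB := (B₀.submoduleOf B).mkQ ∘ₗ fB
  have hA : Function.Surjective gA := by
    refine (Submodule.mkQ_surjective _).comp fun x => ?_
    obtain ⟨y, hy, hxy⟩ := h₁ x x.2
    exact ⟨⟨(x, y), hxy, x.2, hy⟩, rfl⟩
  have hB : Function.Surjective gB := by
    refine (Submodule.mkQ_surjective _).comp fun y => ?_
    obtain ⟨x, hx, hxy⟩ := h₂ y y.2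
    exact ⟨⟨(x, y), hxy, hx, y.2⟩, rfl⟩
  have hker : LinearMap.ker gA = LinearMap.ker gB := by
    ext x
    exact (Submodule.Quotient.mk_eq_zero (A₀.submoduleOf A) (x := fA x)).trans
      ((h₃ _ x.2.2.1 _ x.2.2.2 x.2.1).trans
        (Submodule.Quotient.mk_eq_zero (B₀.submoduleOf B) (x := fB x)).symm)
  exact ⟨(gA.quotKerEquivOfSurjective hA).symm.trans
    ((Submodule.quotEquivOfEq _ _ hker).trans (gB.quotKerEquivOfSurjective hB))⟩

variable {K : Type u} [Field K] {n : ℕ}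

/-! ### Functoriality of the Koszul complex -/

section Map

variable {M : Type v} [AddCommGroup M] [Module K M]
  [Module (MvPolynomial (Fin n) K) M] [IsScalarTower K (MvPolynomial (Fin n) K) M]
  {N : Type w} [AddCommGroup N] [Module K N]
  [Module (MvPolynomial (Fin n) K) N] [IsScalarTower K (MvPolynomial (Fin n) K) N]

/-- The map of Koszul complexes induced by a map of modules. -/
def kmap (g : M →ₗ[MvPolynomial (Fin n) K] N) : KoszulModule K n M →ₗ[K] KoszulModule K n N :=
  (LinearMap.rTensor _ g).restrictScalars K

theorem kmap_tmul (g : M →ₗ[MvPolynomial (Fin n) K] N) (m : M)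
    (y : ExteriorAlgebra (MvPolynomial (Fin n) K) (KoszulL K n)) :
    kmap g (m ⊗ₜ[MvPolynomial (Fin n) K] y) = g m ⊗ₜ[MvPolynomial (Fin n) K] y := rfl

theorem kcoord_kmap (g : M →ₗ[MvPolynomial (Fin n) K] N) (T : Finset (Fin n))
    (w : KoszulModule K n M) : kcoord T (kmap g w) = g (kcoord T w) := by
  conv_lhs => rw [eq_sum_kcoord w]
  simp only [map_sum, kmap_tmul, kcoord_tmul]
  simp

theorem contraction_kmap (g : M →ₗ[MvPolynomial (Fin n) K] N)
    (ν : Module.Dual (MvPolynomial (Fin n) K) (KoszulL K n)) (w : KoszulModule K n M) :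
    contraction N ν (kmap g w) = kmap g (contraction M ν w) := by
  induction w using TensorProduct.induction_on with
  | zero => simp
  | tmul m y => rfl
  | add x y hx hy => simp only [map_add, hx, hy]

theorem kmap_mem {𝓜 : ℤ → Submodule K M} {𝓝 : ℤ → Submodule K N}
    {g : M →ₗ[MvPolynomial (Fin n) K] N} (hg : ∀ k, ∀ m ∈ 𝓜 k, g m ∈ 𝓝 k) {p : ℕ} {q : ℤ}
    {w : KoszulModule K n M} (hw : w ∈ koszulGrading 𝓜 p q) : kmap g w ∈ koszulGrading 𝓝 p q := by
  rw [mem_koszulGrading_iff] at hw ⊢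
  intro T
  rw [kcoord_kmap]
  exact ⟨fun h => hg _ _ ((hw T).1 h), fun h => by rw [(hw T).2 h, map_zero]⟩

/-- Lifting is required only for the coordinates of this `w`, so that `hg` may exploit properties of
`w` such as lying in a kernel. -/
theorem exists_kmap_eq {𝓜 : ℤ → Submodule K M} {𝓝 : ℤ → Submodule K N}
    {g : M →ₗ[MvPolynomial (Fin n) K] N} {p : ℕ} {q : ℤ} {w : KoszulModule K n N}
    (hg : ∀ T, ∀ y ∈ 𝓝 (q - p), kcoord T w = y → ∃ x ∈ 𝓜 (q - p), g x = y)
    (hw : w ∈ koszulGrading 𝓝 p q) : ∃ w' ∈ koszulGrading 𝓜 p q, kmap g w' = w := by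
  classical
  rw [mem_koszulGrading_iff] at hw
  have : ∀ T : Finset (Fin n), ∃ x : M, g x = kcoord T w ∧ (T.card = p → x ∈ 𝓜 (q - p)) ∧
      (T.card ≠ p → x = 0) := by
    intro T
    by_cases hT : T.card = p
    · obtain ⟨x, hx, hgx⟩ := hg T _ ((hw T).1 hT) rfl
      exact ⟨x, hgx, fun _ => hx, fun h => absurd hT h⟩
    · exact ⟨0, by rw [(hw T).2 hT, map_zero], fun h => absurd h hT, fun _ => rfl⟩
  choose x hgx hx hx0 using this
  refine ⟨∑ T, x T ⊗ₜ[MvPolynomial (Fin n) K] extBasis K n T, ?_, ?_⟩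
  · refine Submodule.sum_mem _ fun T _ => ?_
    by_cases hT : T.card = p
    · exact tmul_extBasis_mem hT (hx T hT)
    · rw [hx0 T hT, TensorProduct.zero_tmul]
      exact Submodule.zero_mem _
  · rw [map_sum]
    simp only [kmap_tmul, hgx]
    exact (eq_sum_kcoord w).symm

/-- The coordinatewise map on `M ⊗ ⋀ L` induced by a `K`-linear map. -/
def coordMap (g : M →ₗ[K] N) : KoszulModule K n M →ₗ[K] KoszulModule K n N where
  toFun w := ∑ T, g (kcoord T w) ⊗ₜ[MvPolynomial (Fin n) K] extBasis K n T
  map_add' x y := by simp only [map_add, TensorProduct.add_tmul, Finset.sum_add_distrib]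
  map_smul' k x := by
    simp only [kcoord_smul, map_smul, Finset.smul_sum, TensorProduct.smul_tmul', RingHom.id_apply]

theorem coordMap_tmul (g : M →ₗ[K] N) (m : M) (T : Finset (Fin n)) :
    coordMap g (m ⊗ₜ[MvPolynomial (Fin n) K] extBasis K n T) =
      g m ⊗ₜ[MvPolynomial (Fin n) K] extBasis K n T := by
  classical
  change ∑ T', g (kcoord T' _) ⊗ₜ[MvPolynomial (Fin n) K] extBasis K n T' = _
  rw [Finset.sum_eq_single_of_mem T (Finset.mem_univ _), kcoord_tmul, if_pos rfl]
  intro T' _ h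
  rw [kcoord_tmul, if_neg (Ne.symm h), map_zero, TensorProduct.zero_tmul]

theorem coordMap_tmul_contract (g : M →ₗ[K] N) (m : M) (T : Finset (Fin n)) (i : Fin n) :
    coordMap g (m ⊗ₜ[MvPolynomial (Fin n) K] extContract (stdCoord K n i) (extBasis K n T)) =
      g m ⊗ₜ[MvPolynomial (Fin n) K] extContract (stdCoord K n i) (extBasis K n T) := by
  by_cases hi : i ∈ T
  · obtain ⟨s, hs⟩ := extContract_of_mem (K := K) hi
    rw [hs, tmul_unit_smul, tmul_unit_smul, Units.smul_def, Units.smul_def, map_zsmul,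
      coordMap_tmul]
  · rw [extContract_of_notMem hi, TensorProduct.tmul_zero, TensorProduct.tmul_zero, map_zero]

end Map

/-! ### The Koszul homotopies -/

section Homotopy

variable {M : Type v} [AddCommGroup M] [Module K M]
  [Module (MvPolynomial (Fin n) K) M] [IsScalarTower K (MvPolynomial (Fin n) K) M]

/-- Operators on a graded module that divide by the variables. -/
structure IsDivision (𝓜 : ℤ → Submodule K M) (δ : Fin n → M →ₗ[K] M) : Prop where
  mem : ∀ i k, ∀ m ∈ 𝓜 k, δ i m ∈ 𝓜 (k - 1)
  X_smul_self : ∀ i m, δ i ((MvPolynomial.X i : MvPolynomial (Fin n) K) • m) = m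
  X_smul_of_ne : ∀ i j m, j ≠ i → δ i ((MvPolynomial.X j : MvPolynomial (Fin n) K) • m) =
    (MvPolynomial.X j : MvPolynomial (Fin n) K) • δ i m
  comm : ∀ i j m, δ i (δ j m) = δ j (δ i m)

/-- The homotopy of the Koszul complex belonging to the `i`-th variable. -/
def koszulHomotopy (δ : Fin n → M →ₗ[K] M) (i : Fin n) :
    KoszulModule K n M →ₗ[K] KoszulModule K n M :=
  wedge _ (Pi.basisFun (MvPolynomial (Fin n) K) (Fin n) i) ∘ₗ coordMap (δ i)

variable {𝓜 : ℤ → Submodule K M} {δ : Fin n → M →ₗ[K] M}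

theorem IsDivision.koszulHomotopy_mem (hδ : IsDivision 𝓜 δ) (i : Fin n) {p : ℕ} {q : ℤ}
    {w : KoszulModule K n M} (hw : w ∈ koszulGrading 𝓜 p q) :
    koszulHomotopy δ i w ∈ koszulGrading 𝓜 (p + 1) q := by
  have h1 : coordMap (δ i) w ∈ koszulGrading 𝓜 p (q - 1) := by
    refine koszulGrading_induction (coordMap (δ i)) _ (fun T hT m hm => ?_) hw
    rw [coordMap_tmul]
    refine tmul_extBasis_mem hT ?_
    have := hδ.mem i _ m hm
    rwa [sub_right_comm] at this
  have := wedge_mem (basisFun_mem_koszulLGrading i) h1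
  rwa [sub_add_cancel] at this

/-- The homotopy is `e_i ∧ δ_i`. The terms of `D` with `j ≠ i` cancel because `δ_i` commutes with
`x_j`; the term `j = i` leaves `(f - x_i δ_i f) ⊗ (e_i ∧ ∂_i e_T)`, where `e_i ∧ ∂_i` fixes `e_T` if
`i ∈ T` and kills it otherwise. -/
theorem IsDivision.homotopy_tmul (hδ : IsDivision 𝓜 δ) (i : Fin n) (f : M) (T : Finset (Fin n)) :
    contraction _ (koszulForm K n)
        (koszulHomotopy δ i (f ⊗ₜ[MvPolynomial (Fin n) K] extBasis K n T)) +
      koszulHomotopy δ i (contraction _ (koszulForm K n)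
        (f ⊗ₜ[MvPolynomial (Fin n) K] extBasis K n T)) =
    if i ∈ T then f ⊗ₜ[MvPolynomial (Fin n) K] extBasis K n T else
      ((MvPolynomial.X i : MvPolynomial (Fin n) K) • δ i f)
        ⊗ₜ[MvPolynomial (Fin n) K] extBasis K n T := by
  have h1 : contraction _ (koszulForm K n)
        (koszulHomotopy δ i (f ⊗ₜ[MvPolynomial (Fin n) K] extBasis K n T)) =
      ((MvPolynomial.X i : MvPolynomial (Fin n) K) • δ i f)
        ⊗ₜ[MvPolynomial (Fin n) K] extBasis K n T -
      ∑ j, ((MvPolynomial.X j : MvPolynomial (Fin n) K) • δ i f)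
        ⊗ₜ[MvPolynomial (Fin n) K]
          (extGen K n i * extContract (stdCoord K n j) (extBasis K n T)) := by
    rw [koszulHomotopy, LinearMap.comp_apply, coordMap_tmul, wedge_tmul, contraction_tmul_eq_sum]
    rw [← extGen]
    simp only [koszulForm_basis, extContract_extGen_mul, TensorProduct.tmul_sub,
      Finset.sum_sub_distrib]
    congr 1
    rw [Finset.sum_eq_single_of_mem i (Finset.mem_univ _), if_pos rfl]
    intro j _ hj
    rw [if_neg hj, TensorProduct.tmul_zero]
  have h2 : koszulHomotopy δ i (contraction _ (koszulForm K n)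
        (f ⊗ₜ[MvPolynomial (Fin n) K] extBasis K n T)) =
      ∑ j, δ i ((MvPolynomial.X j : MvPolynomial (Fin n) K) • f)
        ⊗ₜ[MvPolynomial (Fin n) K]
          (extGen K n i * extContract (stdCoord K n j) (extBasis K n T)) := by
    rw [contraction_tmul_eq_sum, map_sum]
    refine Finset.sum_congr rfl fun j _ => ?_
    rw [koszulHomotopy, LinearMap.comp_apply, coordMap_tmul_contract, wedge_tmul,
      koszulForm_basis, extGen]
  have h3 : ∑ j, δ i ((MvPolynomial.X j : MvPolynomial (Fin n) K) • f)
        ⊗ₜ[MvPolynomial (Fin n) K]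
          (extGen K n i * extContract (stdCoord K n j) (extBasis K n T)) -
      ∑ j, ((MvPolynomial.X j : MvPolynomial (Fin n) K) • δ i f)
        ⊗ₜ[MvPolynomial (Fin n) K]
          (extGen K n i * extContract (stdCoord K n j) (extBasis K n T)) =
      (f - (MvPolynomial.X i : MvPolynomial (Fin n) K) • δ i f)
        ⊗ₜ[MvPolynomial (Fin n) K]
          (extGen K n i * extContract (stdCoord K n i) (extBasis K n T)) := by
    rw [← Finset.sum_sub_distrib, Finset.sum_eq_single_of_mem i (Finset.mem_univ _),
      ← TensorProduct.sub_tmul, hδ.X_smul_self]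
    intro j _ hj
    rw [hδ.X_smul_of_ne i j f hj, sub_self]
  rw [h1, h2, sub_add_eq_add_sub, add_sub_assoc, h3]
  split_ifs with hi
  · have : extGen K n i * extContract (stdCoord K n i) (extBasis K n T) = extBasis K n T := by
      have h := extContract_extGen_mul i i (extBasis K n T)
      rw [extGen_mul_of_mem hi, map_zero, if_pos rfl] at h
      exact (sub_eq_zero.1 h.symm).symm
    rw [this, ← TensorProduct.add_tmul, add_sub_cancel]
  · rw [extContract_of_notMem hi, mul_zero, TensorProduct.tmul_zero, add_zero]

theorem IsDivision.kcoord_homotopy (hδ : IsDivision 𝓜 δ) (i : Fin n) (w : KoszulModule K n M)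
    (T : Finset (Fin n)) :
    kcoord T (contraction _ (koszulForm K n) (koszulHomotopy δ i w) +
      koszulHomotopy δ i (contraction _ (koszulForm K n) w)) =
    if i ∈ T then kcoord T w else
      (MvPolynomial.X i : MvPolynomial (Fin n) K) • δ i (kcoord T w) := by
  conv_lhs => rw [eq_sum_kcoord w]
  simp only [map_sum]
  rw [← Finset.sum_add_distrib]
  simp only [hδ.homotopy_tmul]
  rw [map_sum, Finset.sum_eq_single_of_mem T (Finset.mem_univ _)]
  · split_ifs <;> rw [kcoord_tmul, if_pos rfl]
  · intro T' _ h
    split_ifs <;> rw [kcoord_tmul, if_neg h]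

/-- Eliminating the variables in `s` from a Koszul cycle. -/
theorem IsDivision.exists_eliminate [SetLike.GradedSMul (polyGrading K n) 𝓜]
    (hδ : IsDivision 𝓜 δ) {p : ℕ} {q : ℤ} {w : KoszulModule K n M}
    (hw : w ∈ koszulGrading 𝓜 p q)
    (hD : contraction M (koszulForm K n) w = 0) (s : Finset (Fin n)) :
    ∃ y ∈ koszulGrading 𝓜 (p + 1) q, ∃ r, contraction M (koszulForm K n) y + r = w ∧
      ∀ i ∈ s, ∀ T, (i ∈ T → kcoord T r = 0) ∧ δ i (kcoord T r) = 0 := by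
  induction s using Finset.induction_on with
  | empty =>
    exact ⟨0, Submodule.zero_mem _, w, by rw [map_zero, zero_add],
      fun i hi => absurd hi (Finset.notMem_empty i)⟩
  | insert j s hj ih =>
    obtain ⟨y, hy, r, rfl, h⟩ := ih
    have hr : r ∈ koszulGrading 𝓜 p q := by
      have := Submodule.sub_mem _ hw (koszulD_mem hy)
      rwa [add_sub_cancel_left] at this
    have hDr : contraction M (koszulForm K n) r = 0 := by
      rwa [map_add, contraction_contraction, zero_add] at hD
    have hkey : ∀ T, kcoord T (r - contraction M (koszulForm K n) (koszulHomotopy δ j r)) =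
        if j ∈ T then 0 else
          kcoord T r - (MvPolynomial.X j : MvPolynomial (Fin n) K) • δ j (kcoord T r) := by
      intro T
      have h1 := hδ.kcoord_homotopy j r T
      rw [hDr, map_zero, add_zero] at h1
      rw [map_sub, h1]
      split_ifs
      · rw [sub_self]
      · rfl
    -- For the cycle `r`, subtracting `D h_j r` erases the coordinates at `T ∋ j` and removes the
    -- multiples of `x_j` from the others. Variables eliminated earlier stay eliminated because
    -- `δ_i` commutes with `x_j` and `δ_j`.
    refine ⟨y + koszulHomotopy δ j r, Submodule.add_mem _ hy (hδ.koszulHomotopy_mem j hr),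
      r - contraction M (koszulForm K n) (koszulHomotopy δ j r), by rw [map_add]; abel, ?_⟩
    intro i hi T
    rw [hkey]
    split_ifs with hjT
    · exact ⟨fun _ => rfl, map_zero _⟩
    · rcases Finset.mem_insert.1 hi with rfl | hi
      · exact ⟨fun h => absurd h hjT, by rw [map_sub, hδ.X_smul_self, sub_self]⟩
      · obtain ⟨h1, h2⟩ := h i hi T
        refine ⟨fun hiT => ?_, ?_⟩
        · rw [h1 hiT, map_zero, smul_zero, sub_zero]
        · have hji : j ≠ i := by rintro rfl; exact hj hi
          rw [map_sub, hδ.X_smul_of_ne i j _ hji, hδ.comm, h2, map_zero, smul_zero, sub_zero]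

end Homotopy

/-! ### Graded free modules -/

section Free

variable {ι : Type w} {deg : ι → ℤ}

/-- The homogeneous part of a preimage of a homogeneous element. -/
theorem exists_homogeneous_preimage {N : Type*} [AddCommGroup N] [Module K N]
    [Module (MvPolynomial (Fin n) K) N] {𝓝 : ℤ → Submodule K N} (h𝓝 : SumsToZero 𝓝)
    {g : (ι →₀ MvPolynomial (Fin n) K) →ₗ[MvPolynomial (Fin n) K] N}
    (hg : ∀ k, ∀ f ∈ freeGrading K n deg k, g f ∈ 𝓝 k) {k : ℤ} {y : N} (hy : y ∈ 𝓝 k)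
    (hr : ∃ f, g f = y) : ∃ f ∈ freeGrading K n deg k, g f = y := by
  classical
  obtain ⟨f, rfl⟩ := hr
  have hmem : f ∈ ⨆ k, freeGrading K n deg k := by
    rw [iSup_freeGrading]; exact Submodule.mem_top
  obtain ⟨c, hc⟩ := (Submodule.mem_iSup_iff_exists_dfinsupp _ f).1 hmem
  have hsum : f = ∑ k ∈ c.support, (c k : ι →₀ MvPolynomial (Fin n) K) := by
    rw [← hc]
    simp only [DFinsupp.lsum_apply_apply, DFinsupp.sumAddHom_apply, DFinsupp.sum]
    rfl
  -- The component of `f` in degree `k` may be zero, so `k` is added to the index set; subtracting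
  -- the target in degree `k` then gives a homogeneous family with sum zero.
  have hsum' : f = ∑ l ∈ insert k c.support, (c l : ι →₀ MvPolynomial (Fin n) K) := by
    rw [hsum]
    refine Finset.sum_subset (Finset.subset_insert _ _) fun l _ hl => ?_
    rw [DFinsupp.notMem_support_iff.1 hl]
    rfl
  refine ⟨c k, (c k).2, ?_⟩
  have hz := h𝓝 (insert k c.support)
    (fun l => g (c l) - if l = k then g f else 0) (fun l => by
      refine Submodule.sub_mem _ (hg l _ (c l).2) ?_
      split_ifs with h
      · rw [h]; exact hy
      · exact Submodule.zero_mem _)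
    (by
      rw [Finset.sum_sub_distrib, ← map_sum, ← hsum', Finset.sum_ite_eq',
        if_pos (Finset.mem_insert_self _ _), sub_self]) k (Finset.mem_insert_self _ _)
  simpa [sub_eq_zero] using hz

variable (K ι) in
/-- Division by the variable `x_i` with remainder free of `x_i`, on a free module. -/
def divX (i : Fin n) : (ι →₀ MvPolynomial (Fin n) K) →ₗ[K] (ι →₀ MvPolynomial (Fin n) K) :=
  Finsupp.mapRange.linearMap
    { toFun := fun f => f.divMonomial (Finsupp.single i 1)
      map_add' := fun x y => MvPolynomial.add_divMonomial x y _
      map_smul' := fun k x => by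
        ext a
        simp [MvPolynomial.coeff_divMonomial] }

theorem coeff_divX (i : Fin n) (f : ι →₀ MvPolynomial (Fin n) K) (b : ι) (a : Fin n →₀ ℕ) :
    (divX K ι i f b).coeff a = (f b).coeff (Finsupp.single i 1 + a) := by
  change ((f b).divMonomial (Finsupp.single i 1)).coeff a = _
  rw [MvPolynomial.coeff_divMonomial]

theorem divX_mem {i : Fin n} {k : ℤ} {f : ι →₀ MvPolynomial (Fin n) K}
    (hf : f ∈ freeGrading K n deg k) : divX K ι i f ∈ freeGrading K n deg (k - 1) := by
  intro b a ha
  rw [coeff_divX] at ha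
  have := hf b _ ha
  rw [map_add, Finsupp.degree_single] at this
  push_cast at this
  omega

theorem divX_X_smul_self (i : Fin n) (f : ι →₀ MvPolynomial (Fin n) K) :
    divX K ι i ((MvPolynomial.X i : MvPolynomial (Fin n) K) • f) = f := by
  ext b a
  rw [coeff_divX, Finsupp.smul_apply, smul_eq_mul, MvPolynomial.coeff_X_mul]

theorem divX_X_smul_of_ne {i j : Fin n} (h : j ≠ i) (f : ι →₀ MvPolynomial (Fin n) K) :
    divX K ι i ((MvPolynomial.X j : MvPolynomial (Fin n) K) • f) =
      (MvPolynomial.X j : MvPolynomial (Fin n) K) • divX K ι i f := by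
  ext b a
  rw [coeff_divX, Finsupp.smul_apply, smul_eq_mul, Finsupp.smul_apply, smul_eq_mul,
    MvPolynomial.coeff_X_mul', MvPolynomial.coeff_X_mul', coeff_divX]
  have hs : j ∈ (Finsupp.single i 1 + a).support ↔ j ∈ a.support := by
    simp [Ne.symm h]
  rw [if_congr hs rfl rfl]
  split_ifs with hj
  · rw [add_tsub_assoc_of_le]
    rw [Finsupp.single_le_iff]
    exact Nat.one_le_iff_ne_zero.2 (Finsupp.mem_support_iff.1 hj)
  · rfl

theorem divX_divX (i j : Fin n) (f : ι →₀ MvPolynomial (Fin n) K) :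
    divX K ι i (divX K ι j f) = divX K ι j (divX K ι i f) := by
  ext b a
  simp only [coeff_divX, ← add_assoc, add_comm (Finsupp.single i 1) (Finsupp.single j 1)]

variable (K n ι) in
/-- The free `S`-module on `ι`. It is a type synonym, so that its additive group structure is
atomic in the Koszul complex. -/
def FreeMod : Type (max u w) := ι →₀ MvPolynomial (Fin n) K

instance : AddCommGroup (FreeMod K n ι) :=
  inferInstanceAs (AddCommGroup (ι →₀ MvPolynomial (Fin n) K))

instance : Module K (FreeMod K n ι) :=
  inferInstanceAs (Module K (ι →₀ MvPolynomial (Fin n) K))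

instance : Module (MvPolynomial (Fin n) K) (FreeMod K n ι) :=
  inferInstanceAs (Module (MvPolynomial (Fin n) K) (ι →₀ MvPolynomial (Fin n) K))

instance : IsScalarTower K (MvPolynomial (Fin n) K) (FreeMod K n ι) :=
  inferInstanceAs (IsScalarTower K (MvPolynomial (Fin n) K) (ι →₀ MvPolynomial (Fin n) K))

variable (K n ι) in
/-- The identity map from the type synonym. -/
def FreeMod.toFinsupp : FreeMod K n ι →ₗ[MvPolynomial (Fin n) K] (ι →₀ MvPolynomial (Fin n) K) :=
  LinearMap.id (M := ι →₀ MvPolynomial (Fin n) K)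

variable (K n deg) in
/-- The grading of a graded free module. -/
def FreeMod.grading (k : ℤ) : Submodule K (FreeMod K n ι) := freeGrading K n deg k

instance : SetLike.GradedSMul (polyGrading K n) (FreeMod.grading K n deg) :=
  inferInstanceAs (SetLike.GradedSMul (polyGrading K n) (freeGrading K n deg))

variable (K n ι) in
/-- Division by the variable `x_i` on a free module. -/
def FreeMod.divX (i : Fin n) : FreeMod K n ι →ₗ[K] FreeMod K n ι :=
  KoszulBetti.divX K ι i

variable (K deg) in
theorem FreeMod.isDivision_divX : IsDivision (FreeMod.grading K n deg) (FreeMod.divX K n ι) where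
  mem _ _ _ h := divX_mem h
  X_smul_self := divX_X_smul_self
  X_smul_of_ne _ _ f h := divX_X_smul_of_ne h f
  comm := divX_divX

/-- The reduction of the degree zero coordinate modulo the variables. -/
def kred : KoszulModule K n (FreeMod K n ι) →ₗ[K]
    ResidueField K n ⊗[MvPolynomial (Fin n) K] (ι →₀ MvPolynomial (Fin n) K) :=
  (TensorProduct.mk (MvPolynomial (Fin n) K) (ResidueField K n) _
    (ResidueField.one K n) ∘ₗ FreeMod.toFinsupp K n ι ∘ₗ kcoord ∅).restrictScalars K

theorem kred_apply (w : KoszulModule K n (FreeMod K n ι)) :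
    kred w = ResidueField.one K n ⊗ₜ[MvPolynomial (Fin n) K]
      FreeMod.toFinsupp K n ι (kcoord ∅ w) := rfl

theorem one_tmul_X_smul (i : Fin n) (f : ι →₀ MvPolynomial (Fin n) K) :
    ResidueField.one K n ⊗ₜ[MvPolynomial (Fin n) K]
      ((MvPolynomial.X i : MvPolynomial (Fin n) K) • f) = 0 := by
  rw [← TensorProduct.smul_tmul, ResidueField.smul_def, MvPolynomial.constantCoeff_X, zero_smul,
    TensorProduct.zero_tmul]

theorem kred_koszulD (w : KoszulModule K n (FreeMod K n ι)) :
    kred (contraction _ (koszulForm K n) w) = 0 := by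
  rw [eq_sum_kcoord w, map_sum, map_sum]
  refine Finset.sum_eq_zero fun T _ => ?_
  rw [contraction_tmul_eq_sum, map_sum]
  refine Finset.sum_eq_zero fun i _ => ?_
  rw [kred_apply, koszulForm_basis, ← TensorProduct.smul_tmul', map_smul, map_smul, one_tmul_X_smul]

theorem constantCoeff_eq_zero_of_one_tmul {f : ι →₀ MvPolynomial (Fin n) K}
    (hf : ResidueField.one K n ⊗ₜ[MvPolynomial (Fin n) K] f = 0) (b : ι) :
    MvPolynomial.constantCoeff (f b) = 0 := by
  have h := congrArg (fun x => TensorProduct.rid (MvPolynomial (Fin n) K) (ResidueField K n)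
    ((Finsupp.lapply b).lTensor (ResidueField K n) x)) hf
  simp only [LinearMap.lTensor_tmul, TensorProduct.rid_tmul, map_zero, Finsupp.lapply_apply] at h
  rw [ResidueField.smul_def] at h
  have h2 : MvPolynomial.constantCoeff (f b) * (1 : K) = 0 := h
  rwa [mul_one] at h2

/-- The Koszul complex of a graded free module is acyclic, including at the augmentation. -/
theorem exists_koszulD_eq_of_kred_eq_zero {p : ℕ} {q : ℤ}
    {w : KoszulModule K n (FreeMod K n ι)}
    (hw : w ∈ koszulGrading (FreeMod.grading K n deg) p q)
    (hD : contraction _ (koszulForm K n) w = 0) (hr : kred w = 0) :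
    ∃ y ∈ koszulGrading (FreeMod.grading K n deg) (p + 1) q,
      contraction _ (koszulForm K n) y = w := by
  obtain ⟨y, hy, r, rfl, h⟩ := (FreeMod.isDivision_divX K deg).exists_eliminate hw hD Finset.univ
  rw [map_add, kred_koszulD, zero_add] at hr
  -- With every variable eliminated, `r` has no coordinate at a nonempty `T`, and its coordinate at
  -- `∅` has all quotients by variables zero, hence is constant. The vanishing of `kred` removes the
  -- constant.
  have h0 : r = 0 := by
    refine kcoord_ext fun T => ?_
    rw [map_zero]
    rcases T.eq_empty_or_nonempty with rfl | ⟨i, hi⟩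
    · refine Finsupp.ext fun b => MvPolynomial.ext _ _ fun a => ?_
      by_cases ha : a = 0
      · rw [ha]
        exact constantCoeff_eq_zero_of_one_tmul
          (f := FreeMod.toFinsupp K n ι (kcoord ∅ r)) hr b
      · obtain ⟨i, hi⟩ := Finsupp.ne_iff.1 ha
        have h1 : Finsupp.single i 1 ≤ a := by
          rw [Finsupp.single_le_iff]
          exact Nat.one_le_iff_ne_zero.2 hi
        have h2 := coeff_divX i (FreeMod.toFinsupp K n ι (kcoord ∅ r)) b (a - Finsupp.single i 1)
        rw [add_tsub_cancel_of_le h1] at h2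
        have h3 : divX K ι i (FreeMod.toFinsupp K n ι (kcoord ∅ r)) = 0 :=
          (h i (Finset.mem_univ _) ∅).2
        rw [h3] at h2
        exact h2.symm
    · exact (h i (Finset.mem_univ _) T).1 hi
  exact ⟨y, hy, by rw [h0, add_zero]⟩

theorem exists_koszulD_eq {p : ℕ} {q : ℤ}
    {w : KoszulModule K n (FreeMod K n ι)}
    (hw : w ∈ koszulGrading (FreeMod.grading K n deg) (p + 1) q)
    (hD : contraction _ (koszulForm K n) w = 0) :
    ∃ y ∈ koszulGrading (FreeMod.grading K n deg) (p + 1 + 1) q,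
      contraction _ (koszulForm K n) y = w := by
  refine exists_koszulD_eq_of_kred_eq_zero hw hD ?_
  rw [kred_apply, (mem_koszulGrading_iff.1 hw ∅).2 (by simp), map_zero, TensorProduct.tmul_zero]

end Free

end

section

variable {K : Type u} [Field K] {n : ℕ} {M : Type v} [AddCommGroup M] [Module K M]
  [Module (MvPolynomial (Fin n) K) M] [IsScalarTower K (MvPolynomial (Fin n) K) M]

namespace GradedFreeResolution

variable {𝓜 : ℤ → Submodule K M} (F : GradedFreeResolution (n := n) 𝓜)

/-! ### The double complex of the Koszul complex and a graded free resolution -/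

/-- The Koszul complex of the `b`-th module of the resolution. -/
abbrev Dbl (b : ℕ) := KoszulModule K n (FreeMod K n (F.ι b))

/-- The component of internal degree `j` at the spot `(a, b)` of the double complex. -/
abbrev dbl (j : ℤ) (a b : ℕ) : Submodule K (F.Dbl b) :=
  koszulGrading (FreeMod.grading K n (F.deg b)) a j

/-- The Koszul differential of the double complex. -/
abbrev dblD (b : ℕ) : F.Dbl b →ₗ[K] F.Dbl b := contraction _ (koszulForm K n)

/-- The differential of the resolution. -/
abbrev modd (b : ℕ) : FreeMod K n (F.ι (b + 1)) →ₗ[MvPolynomial (Fin n) K] FreeMod K n (F.ι b) :=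
  F.d b

/-- The augmentation of the resolution. -/
abbrev modε : FreeMod K n (F.ι 0) →ₗ[MvPolynomial (Fin n) K] M := F.ε

/-- The resolution differential of the double complex. -/
abbrev dbld (b : ℕ) : F.Dbl (b + 1) →ₗ[K] F.Dbl b := kmap (F.modd b)

theorem dbld_dbld (b : ℕ) (w : F.Dbl (b + 2)) : F.dbld b (F.dbld (b + 1) w) = 0 := by
  refine kcoord_ext fun T => ?_
  rw [kcoord_kmap, kcoord_kmap, map_zero]
  exact (F.exact_succ b).apply_apply_eq_zero _

theorem kmap_ε_dbld (w : F.Dbl 1) : kmap F.modε (F.dbld 0 w) = 0 := by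
  refine kcoord_ext fun T => ?_
  rw [kcoord_kmap, kcoord_kmap, map_zero]
  exact F.exact_zero.apply_apply_eq_zero _

variable {j : ℤ}

theorem dbld_mem {a b : ℕ} {w : F.Dbl (b + 1)} (hw : w ∈ F.dbl j a (b + 1)) :
    F.dbld b w ∈ F.dbl j a b := kmap_mem (F.d_mem b) hw

theorem dblD_mem {a b : ℕ} {w : F.Dbl b} (hw : w ∈ F.dbl j (a + 1) b) :
    F.dblD b w ∈ F.dbl j a b := koszulD_mem hw

theorem exists_dbld_eq {a b : ℕ} {w : F.Dbl (b + 1)} (hw : w ∈ F.dbl j a (b + 1))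
    (h : F.dbld b w = 0) : ∃ w' ∈ F.dbl j a (b + 2), F.dbld (b + 1) w' = w := by
  refine exists_kmap_eq (fun T y hy hT => ?_) hw
  have h0 : F.modd b y = 0 := by rw [← hT, ← kcoord_kmap, h, map_zero]
  exact exists_homogeneous_preimage (freeGrading_sum_eq_zero _) (F.d_mem (b + 1)) hy
    ((F.exact_succ b y).1 h0)

theorem exists_dbld_zero_eq {a : ℕ} {w : F.Dbl 0} (hw : w ∈ F.dbl j a 0)
    (h : kmap F.modε w = 0) : ∃ w' ∈ F.dbl j a 1, F.dbld 0 w' = w := by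
  refine exists_kmap_eq (fun T y hy hT => ?_) hw
  have h0 : F.modε y = 0 := by rw [← hT, ← kcoord_kmap, h, map_zero]
  exact exists_homogeneous_preimage (freeGrading_sum_eq_zero _) (F.d_mem 0) hy
    ((F.exact_zero y).1 h0)

theorem exists_kmap_ε_eq (h𝓜 : SumsToZero 𝓜) {a : ℕ} {w : KoszulModule K n M}
    (hw : w ∈ koszulGrading 𝓜 a j) : ∃ w' ∈ F.dbl j a 0, kmap F.modε w' = w :=
  exists_kmap_eq (fun _ y hy _ =>
    exists_homogeneous_preimage h𝓜 F.ε_mem hy (F.ε_surjective y)) hw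

/-- The elements at `(a, b)` whose Koszul differential comes from the resolution. -/
def liftableD (j : ℤ) : ℕ → ∀ b : ℕ, Submodule K (F.Dbl b)
  -- In Koszul degree zero the Koszul differential vanishes, so there is no condition.
  | 0, _ => ⊤
  | a + 1, b => ((F.dbl j a (b + 1)).map (F.dbld b)).comap (F.dblD b)

/-- The elements at `(a, b)` whose resolution differential is a Koszul boundary. -/
def liftabled (j : ℤ) : ℕ → ∀ b : ℕ, Submodule K (F.Dbl b)
  -- The augmentation is not part of the double complex, so nothing leaves column `0`.
  | _, 0 => ⊤
  | a, b + 1 => ((F.dbl j (a + 1) b).map (F.dblD b)).comap (F.dbld b)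

/-- The zigzag cycles at `(a, b)`. -/
def zigCycles (j : ℤ) (a b : ℕ) : Submodule K (F.Dbl b) :=
  F.dbl j a b ⊓ (F.liftableD j a b ⊓ F.liftabled j a b)

/-- The zigzag boundaries at `(a, b)`. -/
def zigBoundaries (j : ℤ) (a b : ℕ) : Submodule K (F.Dbl b) :=
  (F.dbl j (a + 1) b).map (F.dblD b) ⊔ (F.dbl j a (b + 1)).map (F.dbld b)

/-- The zigzag homology at `(a, b)`. -/
abbrev Zig (j : ℤ) (a b : ℕ) :=
  F.zigCycles j a b ⧸ (F.zigBoundaries j a b).submoduleOf (F.zigCycles j a b)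

/-! ### Isomorphisms along a diagonal of the double complex -/

theorem dblD_dbld (b : ℕ) (w : F.Dbl (b + 1)) :
    F.dblD b (F.dbld b w) = F.dbld b (F.dblD (b + 1) w) := contraction_kmap _ _ _

theorem mem_zigBoundaries {a b : ℕ} {w : F.Dbl b} : w ∈ F.zigBoundaries j a b ↔
    ∃ x ∈ F.dbl j (a + 1) b, ∃ y ∈ F.dbl j a (b + 1), F.dblD b x + F.dbld b y = w := by
  rw [zigBoundaries, Submodule.mem_sup]
  constructor
  · rintro ⟨_, ⟨x, hx, rfl⟩, _, ⟨y, hy, rfl⟩, h⟩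
    exact ⟨x, hx, y, hy, h⟩
  · rintro ⟨x, hx, y, hy, h⟩
    exact ⟨_, ⟨x, hx, rfl⟩, _, ⟨y, hy, rfl⟩, h⟩

/-- The relation is `D x = d y`. Passing from `x` to `y` uses exactness of the resolution at `b +
1`; passing back uses acyclicity of the Koszul complex in the positive degree `a + 1`. -/
theorem nonempty_zig_step (j : ℤ) (a b : ℕ) :
    Nonempty (F.Zig j (a + 1) b ≃ₗ[K] F.Zig j a (b + 1)) := by
  refine nonempty_quotient_equiv_of_relation _ _ _ _
    (LinearMap.eqLocus (F.dblD b ∘ₗ LinearMap.fst K (F.Dbl b) (F.Dbl (b + 1)))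
      (F.dbld b ∘ₗ LinearMap.snd K (F.Dbl b) (F.Dbl (b + 1)))) ?_ ?_ ?_
  · rintro x ⟨hx, ⟨y, hy, hxy⟩, -⟩
    refine ⟨y, ⟨hy, ?_, ⟨x, hx, hxy.symm⟩⟩, hxy.symm⟩
    cases a with
    | zero => exact Submodule.mem_top
    | succ a =>
      refine F.exists_dbld_eq (F.dblD_mem hy) ?_
      rw [← dblD_dbld, hxy, contraction_contraction]
  · rintro y ⟨hy, -, ⟨x, hx, hxy⟩⟩
    refine ⟨x, ⟨hx, ⟨y, hy, hxy.symm⟩, ?_⟩, hxy⟩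
    cases b with
    | zero => exact Submodule.mem_top
    | succ b =>
      refine exists_koszulD_eq (F.dbld_mem hx) ?_
      rw [dblD_dbld, hxy, dbld_dbld]
  · rintro x ⟨hx, -⟩ y ⟨hy, -⟩ hxy
    have hxy : F.dblD b x = F.dbld b y := hxy
    rw [mem_zigBoundaries, mem_zigBoundaries]
    constructor
    · rintro ⟨g, hg, h, hh, rfl⟩
      rw [map_add, contraction_contraction, zero_add, dblD_dbld] at hxy
      have h0 : F.dbld b (y - F.dblD (b + 1) h) = 0 := by
        rw [map_sub, hxy, sub_self]
      obtain ⟨k, hk, hkx⟩ := F.exists_dbld_eq (Submodule.sub_mem _ hy (F.dblD_mem hh)) h0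
      exact ⟨h, hh, k, hk, by rw [hkx]; abel⟩
    · rintro ⟨g, hg, h, hh, rfl⟩
      rw [map_add, dbld_dbld, add_zero, ← dblD_dbld] at hxy
      have h0 : F.dblD b (x - F.dbld b g) = 0 := by
        rw [map_sub, hxy, sub_self]
      obtain ⟨k, hk, hkx⟩ := exists_koszulD_eq (Submodule.sub_mem _ hx (F.dbld_mem hg)) h0
      exact ⟨k, hk, g, hg, by rw [hkx]; abel⟩

/-- At the end `b = 0` of the diagonal the relation is `ε x = y`: modulo the image of `d`, which is
the kernel of `ε`, the column `F_0` is the Koszul complex of `M`. -/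
theorem nonempty_zig_koszul [SetLike.GradedSMul (polyGrading K n) 𝓜] (h𝓜 : SumsToZero 𝓜)
    (j : ℤ) (i : ℕ) : Nonempty (F.Zig j i 0 ≃ₗ[K] KoszulHomology n 𝓜 i j) := by
  refine nonempty_quotient_equiv_of_relation _ _ _ _
    (LinearMap.eqLocus (kmap F.modε ∘ₗ LinearMap.fst K (F.Dbl 0) (KoszulModule K n M))
      (LinearMap.snd K (F.Dbl 0) (KoszulModule K n M))) ?_ ?_ ?_
  · rintro x ⟨hx, hD, -⟩
    refine ⟨kmap F.modε x, ⟨kmap_mem F.ε_mem hx, ?_⟩, rfl⟩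
    cases i with
    | zero => exact contraction_eq_zero _ (kmap_mem F.ε_mem hx)
    | succ i =>
      obtain ⟨y, hy, hxy⟩ := hD
      refine (contraction_kmap _ _ _).trans ?_
      exact (congrArg _ hxy.symm).trans (F.kmap_ε_dbld y)
  · rintro y ⟨hy, hD⟩
    obtain ⟨x, hx, rfl⟩ := F.exists_kmap_ε_eq h𝓜 hy
    refine ⟨x, ⟨hx, ?_, Submodule.mem_top⟩, rfl⟩
    cases i with
    | zero => exact Submodule.mem_top
    | succ i =>
      exact F.exists_dbld_zero_eq (F.dblD_mem hx) ((contraction_kmap _ _ _).symm.trans hD)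
  · rintro x ⟨hx, -⟩ y ⟨hy, -⟩ hxy
    have hxy : kmap F.modε x = y := hxy
    rw [mem_zigBoundaries, ← hxy]
    constructor
    · rintro ⟨g, hg, h, hh, rfl⟩
      refine ⟨kmap F.modε g, kmap_mem F.ε_mem hg, ?_⟩
      rw [map_add, kmap_ε_dbld, add_zero, contraction_kmap]
    · rintro ⟨m, hm, hmx⟩
      obtain ⟨g, hg, rfl⟩ := F.exists_kmap_ε_eq h𝓜 hm
      rw [contraction_kmap] at hmx
      have h0 : kmap F.modε (x - F.dblD 0 g) = 0 := by rw [map_sub, hmx, sub_self]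
      obtain ⟨k, hk, hkx⟩ := F.exists_dbld_zero_eq (Submodule.sub_mem _ hx (F.dblD_mem hg)) h0
      exact ⟨g, hg, k, hk, by rw [hkx]; abel⟩

theorem redD_kred (b : ℕ) (w : F.Dbl (b + 1)) : F.redD b (kred w) = kred (F.dbld b w) := by
  rw [kred_apply, kred_apply, kcoord_kmap]
  rfl

theorem kred_mem {b : ℕ} {w : F.Dbl b} (hw : w ∈ F.dbl j 0 b) : kred w ∈ F.redGrading b j := by
  refine Submodule.subset_span ⟨FreeMod.toFinsupp K n _ (kcoord ∅ w), ?_, kred_apply w⟩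
  have := (mem_koszulGrading_iff.1 hw ∅).1 rfl
  rw [Nat.cast_zero, sub_zero] at this
  exact this

theorem exists_kred_eq {b : ℕ} {r : F.Red b} (hr : r ∈ F.redGrading b j) :
    ∃ w ∈ F.dbl j 0 b, kred w = r := by
  suffices h : F.redGrading b j ≤ (F.dbl j 0 b).map kred from h hr
  rw [redGrading, Submodule.span_le]
  rintro _ ⟨f, hf, rfl⟩
  have hf' : (show FreeMod K n (F.ι b) from f) ∈
      FreeMod.grading K n (F.deg b) (j - ((0 : ℕ) : ℤ)) := by
    rw [Nat.cast_zero, sub_zero]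
    exact hf
  refine ⟨_, tmul_extBasis_mem Finset.card_empty hf', ?_⟩
  rw [kred_apply, kcoord_tmul, if_pos rfl]
  rfl

/-- At the end `a = 0` the relation is reduction modulo the variables: in Koszul degree zero the
boundaries of `D` are exactly the kernel of that reduction. -/
theorem nonempty_zig_tor (j : ℤ) (i : ℕ) : Nonempty (F.Zig j 0 i ≃ₗ[K] F.Tor i j) := by
  refine nonempty_quotient_equiv_of_relation _ _ _ _
    (LinearMap.eqLocus (kred ∘ₗ LinearMap.fst K (F.Dbl i) (F.Red i))
      (LinearMap.snd K (F.Dbl i) (F.Red i))) ?_ ?_ ?_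
  · rintro x ⟨hx, -, hd⟩
    refine ⟨kred x, ?_, rfl⟩
    cases i with
    | zero => exact F.kred_mem hx
    | succ i =>
      refine ⟨F.kred_mem hx, ?_⟩
      obtain ⟨y, hy, hxy⟩ := hd
      refine (F.redD_kred i x).trans ?_
      rw [← hxy, kred_koszulD]
  · intro r hr
    have hr' : r ∈ F.redGrading i j := by
      cases i with
      | zero => exact hr
      | succ i => exact hr.1
    obtain ⟨x, hx, rfl⟩ := F.exists_kred_eq hr'
    refine ⟨x, ⟨hx, Submodule.mem_top, ?_⟩, rfl⟩
    cases i with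
    | zero => exact Submodule.mem_top
    | succ i =>
      have h0 : kred (F.dbld i x) = 0 := (F.redD_kred i x).symm.trans hr.2
      exact exists_koszulD_eq_of_kred_eq_zero (F.dbld_mem hx)
        (contraction_eq_zero _ (F.dbld_mem hx)) h0
  · rintro x ⟨hx, -⟩ r hr hxr
    have hxr : kred x = r := hxr
    rw [mem_zigBoundaries, ← hxr]
    constructor
    · rintro ⟨g, hg, h, hh, rfl⟩
      refine ⟨kred h, F.kred_mem hh, ?_⟩
      rw [map_add, kred_koszulD, zero_add, redD_kred]
    · rintro ⟨m, hm, hmx⟩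
      obtain ⟨h, hh, rfl⟩ := F.exists_kred_eq hm
      rw [redD_kred] at hmx
      have h0 : kred (x - F.dbld i h) = 0 := by rw [map_sub, hmx, sub_self]
      have hmem := Submodule.sub_mem _ hx (F.dbld_mem hh)
      obtain ⟨k, hk, hkx⟩ :=
        exists_koszulD_eq_of_kred_eq_zero hmem (contraction_eq_zero _ hmem) h0
      exact ⟨k, hk, h, hh, by rw [hkx]; abel⟩

theorem nonempty_zig_diagonal (j : ℤ) (a b : ℕ) :
    Nonempty (F.Zig j a b ≃ₗ[K] F.Zig j 0 (b + a)) := by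
  induction a generalizing b with
  | zero => exact ⟨LinearEquiv.refl _ _⟩
  | succ a ih =>
    obtain ⟨f⟩ := F.nonempty_zig_step j a b
    obtain ⟨g⟩ := ih (b + 1)
    rw [Nat.add_right_comm b 1 a] at g
    exact ⟨f.trans g⟩

/-- Graded Tor is Koszul homology. -/
theorem nonempty_tor_equiv [SetLike.GradedSMul (polyGrading K n) 𝓜] (h𝓜 : SumsToZero 𝓜)
    (i : ℕ) (j : ℤ) : Nonempty (F.Tor i j ≃ₗ[K] KoszulHomology n 𝓜 i j) := by
  obtain ⟨f⟩ := F.nonempty_zig_koszul h𝓜 j i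
  obtain ⟨g⟩ := F.nonempty_zig_diagonal j i 0
  rw [zero_add] at g
  obtain ⟨h⟩ := F.nonempty_zig_tor j i
  exact ⟨h.symm.trans (g.symm.trans f)⟩

end GradedFreeResolution

/-- The comparison holds for every graded free resolution, so the choice made in `betti` is
harmless. -/
theorem betti_eq_finrank_koszulHomology (𝓜 : ℤ → Submodule K M) [DirectSum.Decomposition 𝓜]
    [SetLike.GradedSMul (polyGrading K n) 𝓜] (i : ℕ) (j : ℤ) :
    betti (n := n) 𝓜 i j = Module.finrank K (KoszulHomology n 𝓜 i j) := by
  obtain ⟨f⟩ := (Classical.choice (GradedFreeResolution.nonempty (n := n) 𝓜)).nonempty_tor_equiv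
    (sumsToZero_of_decomposition 𝓜) i j
  exact f.finrank_eq

end

section

variable {K : Type u} [Field K] {n : ℕ} {M : Type v} [AddCommGroup M] [Module K M]
  [Module (MvPolynomial (Fin n) K) M] [IsScalarTower K (MvPolynomial (Fin n) K) M]

/-! ### Finiteness -/

theorem finite_polyGrading (k : ℤ) : Module.Finite K (polyGrading K n k) := by
  by_cases hk : 0 ≤ k
  · lift k to ℕ using hk
    rw [polyGrading_natCast]
    exact Module.Finite.iff_fg.2 (MvPolynomial.homogeneousSubmodule_fg _ _ k)
  · have : polyGrading K n k = ⊥ := by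
      refine eq_bot_iff.2 fun f hf => ?_
      rw [Submodule.mem_bot]
      ext a
      by_contra hne
      have := hf a hne
      omega
    rw [this]
    infer_instance

theorem finite_freeGrading {ι : Type*} [Finite ι] (deg : ι → ℤ) (k : ℤ) :
    Module.Finite K (freeGrading K n deg k) := by
  have := fun b => finite_polyGrading (K := K) (n := n) (k - deg b)
  let φ : freeGrading K n deg k →ₗ[K] ∀ b, polyGrading K n (k - deg b) :=
    LinearMap.pi fun b => ((Finsupp.lapply b).comp (freeGrading K n deg k).subtype).codRestrict _
      fun f => f.2 b
  refine Module.Finite.of_injective φ fun f g h => ?_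
  ext1
  refine Finsupp.ext fun b => ?_
  exact congrArg Subtype.val (congrFun h b)

theorem finite_grading_of_span {ι : Type*} [Finite ι] (deg : ι → ℤ) {𝓜 : ℤ → Submodule K M}
    (h𝓜 : SumsToZero 𝓜) [SetLike.GradedSMul (polyGrading K n) 𝓜] {x : ι → M}
    (hx : ∀ b, x b ∈ 𝓜 (deg b))
    (hspan : Submodule.span (MvPolynomial (Fin n) K) (Set.range x) = ⊤) (k : ℤ) :
    Module.Finite K (𝓜 k) := by
  let φ := Finsupp.linearCombination (MvPolynomial (Fin n) K) x
  have hφ : ∀ k, ∀ f ∈ freeGrading K n deg k, φ f ∈ 𝓜 k := fun k f hf =>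
    linearCombination_mem hx hf
  have hsurj : Function.Surjective φ := by
    rw [← LinearMap.range_eq_top, Finsupp.range_linearCombination, hspan]
  have := finite_freeGrading (K := K) (n := n) deg k
  let ψ : freeGrading K n deg k →ₗ[K] 𝓜 k :=
    ((φ.restrictScalars K).comp (freeGrading K n deg k).subtype).codRestrict _
      fun f => hφ k f f.2
  refine Module.Finite.of_surjective ψ fun m => ?_
  obtain ⟨f, hf, hfm⟩ := exists_homogeneous_preimage h𝓜 hφ m.2 (hsurj m)
  exact ⟨⟨f, hf⟩, Subtype.ext hfm⟩

/-- The components of a finitely generated graded module are finite-dimensional. -/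
theorem finite_grading [Module.Finite (MvPolynomial (Fin n) K) M]
    (𝓜 : ℤ → Submodule K M) [DirectSum.Decomposition 𝓜]
    [SetLike.GradedSMul (polyGrading K n) 𝓜] (k : ℤ) : Module.Finite K (𝓜 k) := by
  classical
  obtain ⟨s, hs⟩ := Module.Finite.fg_top (R := MvPolynomial (Fin n) K) (M := M)
  refine finite_grading_of_span (n := n)
    (ι := Σ m : s, (DirectSum.decompose 𝓜 (m : M)).support)
    (fun b => b.2) (sumsToZero_of_decomposition 𝓜)
    (x := fun b => DirectSum.decompose 𝓜 (b.1 : M) b.2)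
    (fun b => (DirectSum.decompose 𝓜 (b.1 : M) b.2).2) ?_ k
  rw [eq_top_iff, ← hs, Submodule.span_le]
  intro y hy
  rw [SetLike.mem_coe, ← DirectSum.sum_support_decompose 𝓜 y]
  exact Submodule.sum_mem _ fun l hl => Submodule.subset_span ⟨⟨⟨y, hy⟩, ⟨l, hl⟩⟩, rfl⟩

theorem finite_koszulGrading {𝓜 : ℤ → Submodule K M} (p : ℕ) (q : ℤ)
    [Module.Finite K (𝓜 (q - p))] : Module.Finite K (koszulGrading (n := n) 𝓜 p q) := by
  let φ : koszulGrading (n := n) 𝓜 p q →ₗ[K] Finset (Fin n) → 𝓜 (q - p) :=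
    LinearMap.pi fun T => (((kcoord T).restrictScalars K).comp
      (koszulGrading (n := n) 𝓜 p q).subtype).codRestrict _ fun w => by
        by_cases hT : T.card = p
        · exact (mem_koszulGrading_iff.1 w.2 T).1 hT
        · change kcoord T w.1 ∈ _
          rw [(mem_koszulGrading_iff.1 w.2 T).2 hT]
          exact Submodule.zero_mem _
  refine Module.Finite.of_injective φ fun w w' h => Subtype.ext (kcoord_ext fun T => ?_)
  exact congrArg Subtype.val (congrFun h T)

theorem finite_koszulHomology [Module.Finite (MvPolynomial (Fin n) K) M]
    (𝓜 : ℤ → Submodule K M) [DirectSum.Decomposition 𝓜]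
    [SetLike.GradedSMul (polyGrading K n) 𝓜] (p : ℕ) (q : ℤ) :
    Module.Finite K (KoszulHomology n 𝓜 p q) := by
  have := finite_grading (n := n) 𝓜 (q - p)
  have := finite_koszulGrading (n := n) (𝓜 := 𝓜) p q
  have : Module.Finite K (koszulCycles (n := n) 𝓜 p q) :=
    Module.Finite.of_injective (Submodule.inclusion inf_le_left) (Submodule.inclusion_injective _)
  infer_instance

/-! ### The action of constant linear forms on Koszul homology -/

theorem koszulClass_eq_zero_iff {𝓜 : ℤ → Submodule K M} {p : ℕ} {q : ℤ} {z : KoszulModule K n M}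
    (hz : z ∈ koszulCycles 𝓜 p q) : koszulClass 𝓜 p q z hz = 0 ↔ z ∈ koszulBoundaries 𝓜 p q := by
  exact Submodule.Quotient.mk_eq_zero _

theorem koszulClass_congr {𝓜 : ℤ → Submodule K M} {p : ℕ} {q : ℤ} {z z' : KoszulModule K n M}
    (h : z = z') (hz : z ∈ koszulCycles 𝓜 p q) (hz' : z' ∈ koszulCycles 𝓜 p q) :
    koszulClass 𝓜 p q z hz = koszulClass 𝓜 p q z' hz' := by
  subst h; rfl

theorem contraction_mem_koszulCycles {𝓜 : ℤ → Submodule K M}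
    [SetLike.GradedSMul (polyGrading K n) 𝓜] {p : ℕ} {q : ℤ} {z : KoszulModule K n M}
    (hz : z ∈ koszulCycles 𝓜 (p + 1) (q + 1)) (k : Fin n → K) :
    contraction M (constForm k) z ∈ koszulCycles 𝓜 p q := by
  refine ⟨?_, ?_⟩
  · have := contraction_mem (d := 0) (fun i => by
      rw [constForm_basis k i]; exact C_mem_polyGrading _) hz.1
    rwa [add_zero, add_sub_cancel_right] at this
  · have h : contraction M (koszulForm K n) z = 0 := hz.2
    change contraction M (koszulForm K n) (contraction M (constForm k) z) = 0
    rw [contraction_comm, h, map_zero, neg_zero]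

/-- Contraction of an element of the Koszul complex by varying constant linear forms. -/
def constContraction (z : KoszulModule K n M) : (Fin n → K) →ₗ[K] KoszulModule K n M :=
  ∑ i, (LinearMap.proj i).smulRight (contraction M (stdCoord K n i) z)

theorem constContraction_apply (z : KoszulModule K n M) (k : Fin n → K) :
    constContraction z k = contraction M (constForm k) z := by
  induction z using TensorProduct.induction_on with
  | zero => simp [constContraction]
  | tmul m y =>
    rw [contraction_tmul_eq_sum, constContraction, LinearMap.sum_apply]
    refine Finset.sum_congr rfl fun i _ => ?_
    rw [constForm_basis, LinearMap.smulRight_apply, contraction_tmul, TensorProduct.smul_tmul',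
      ← MvPolynomial.algebraMap_eq, algebraMap_smul]
    rfl
  | add x y hx hy =>
    rw [map_add, ← hx, ← hy]
    simp only [constContraction, LinearMap.sum_apply, LinearMap.smulRight_apply, map_add, smul_add,
      Finset.sum_add_distrib]

/-- A non-zero Koszul class whose contractions all lie on the first non-zero strand has at least
as many linearly independent contractions as its homological degree. -/
theorem exists_linearIndependent_contractions {𝓜 : ℤ → Submodule K M}
    [SetLike.GradedSMul (polyGrading K n) 𝓜] (hM : ∀ k : ℤ, k < 0 → 𝓜 k = ⊥)
    {p t : ℕ} (hpn : p + 1 ≤ n) {q q' : ℤ} (hq' : q' = p + t) (hq : q = q' + 1)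
    (H : ∀ l : ℕ, l < t → koszulCycles (n := n) 𝓜 p (p + l) ≤ koszulBoundaries 𝓜 p (p + l))
    {z : KoszulModule K n M} (hz : z ∈ koszulCycles 𝓜 (p + 1) q)
    (hzb : z ∉ koszulBoundaries 𝓜 (p + 1) q) :
    ∃ e : Module.Basis (Fin n) (MvPolynomial (Fin n) K) (KoszulL K n),
      (∀ i, e i ∈ koszulLGrading K n 1) ∧
      ∃ hdz : ∀ i : Fin (p + 1), contraction M (e.coord (Fin.castLE hpn i)) z ∈
          koszulCycles 𝓜 p q',
        LinearIndependent K (fun i : Fin (p + 1) =>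
          koszulClass 𝓜 p q' (contraction M (e.coord (Fin.castLE hpn i)) z) (hdz i)) := by
  have hmem : ∀ k, contraction M (constForm k) z ∈ koszulCycles 𝓜 p q' :=
    contraction_mem_koszulCycles (hq ▸ hz)
  let θ : (Fin n → K) →ₗ[K] KoszulHomology n 𝓜 p q' :=
    Submodule.mkQ _ ∘ₗ (constContraction z).codRestrict (koszulCycles 𝓜 p q') fun k => by
      rw [constContraction_apply]; exact hmem k
  have hθ : ∀ k, θ k = koszulClass 𝓜 p q' _ (hmem k) := fun k =>
    koszulClass_congr (constContraction_apply z k) _ _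
  obtain ⟨f, r, hr, hzero, hli⟩ := exists_adapted_basis θ
  obtain ⟨e, he, hcoord⟩ := exists_isLinearBasis f
  -- If the rank `r` were at most `p`, all contractions from index `r` on would be boundaries, and
  -- so would `z`.
  have hpr : p + 1 ≤ r := by
    by_contra hlt
    refine hzb (mem_koszulBoundaries_of_contractions he hM H (by rw [hq, hq']) hz.1
      (Nat.lt_of_not_le hlt) fun i hi => ?_)
    rw [hcoord, ← hq', ← koszulClass_eq_zero_iff (hmem (f i)), ← hθ]
    exact hzero i hi
  have hdz : ∀ i : Fin (p + 1), contraction M (e.coord (Fin.castLE hpn i)) z ∈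
      koszulCycles 𝓜 p q' := fun i => by rw [hcoord]; exact hmem _
  refine ⟨e, he.mem, hdz, ?_⟩
  have h2 := hli.comp (Fin.castLE hpr) (Fin.castLE_injective hpr)
  have h3 : (fun i : Fin r => θ (f (Fin.castLE hr i))) ∘ Fin.castLE hpr = fun i =>
      koszulClass 𝓜 p q' (contraction M (e.coord (Fin.castLE hpn i)) z) (hdz i) := by
    funext i
    rw [Function.comp_apply, hθ]
    exact koszulClass_congr (by rw [hcoord]; rfl) _ _
  rw [h3] at h2
  exact h2

end

end KoszulBetti

end

/-! ### The theorem for Betti numbers -/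

theorem theorem2p5 {K : Type*} [Field K] {n : ℕ} {M : Type*} [AddCommGroup M] [Module K M]
    [Module (MvPolynomial (Fin n) K) M] [IsScalarTower K (MvPolynomial (Fin n) K) M]
    [Module.Finite (MvPolynomial (Fin n) K) M]
    (𝓜 : ℤ → Submodule K M) [DirectSum.Decomposition 𝓜]
    [SetLike.GradedSMul (KoszulBetti.polyGrading K n) 𝓜]
    (hM : ∀ k : ℤ, k < 0 → 𝓜 k = ⊥)
    (t p : ℕ) (hp : 1 ≤ p) (hpn : p ≤ n)
    (hvanish : ∀ l : ℤ, -1 ≤ l → l < t →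
      KoszulBetti.betti (n := n) 𝓜 (p - 1) ((p : ℤ) - 1 + l) = 0)
    (hne : KoszulBetti.betti (n := n) 𝓜 p ((p : ℤ) + t) ≠ 0) :
    (∃ e : Module.Basis (Fin n) (MvPolynomial (Fin n) K) (KoszulBetti.KoszulL K n),
      (∀ i, e i ∈ KoszulBetti.koszulLGrading K n 1) ∧
      ∃ (z : KoszulBetti.KoszulModule K n M)
        (hz : z ∈ KoszulBetti.koszulCycles 𝓜 p ((p : ℤ) + t))
        (hdz : ∀ i : Fin p, KoszulBetti.contraction M (e.coord (Fin.castLE hpn i)) z ∈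
          KoszulBetti.koszulCycles 𝓜 (p - 1) ((p : ℤ) - 1 + t)),
        KoszulBetti.koszulClass 𝓜 p ((p : ℤ) + t) z hz ≠ 0 ∧
        LinearIndependent K (fun i : Fin p =>
          KoszulBetti.koszulClass 𝓜 (p - 1) ((p : ℤ) - 1 + t)
            (KoszulBetti.contraction M (e.coord (Fin.castLE hpn i)) z) (hdz i))) ∧
    p ≤ KoszulBetti.betti (n := n) 𝓜 (p - 1) ((p : ℤ) - 1 + t) := by
  obtain ⟨p, rfl⟩ : ∃ p', p = p' + 1 := ⟨p - 1, by omega⟩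
  have H : ∀ l : ℕ, l < t → KoszulBetti.koszulCycles (n := n) 𝓜 p (p + l) ≤
      KoszulBetti.koszulBoundaries 𝓜 p (p + l) := by
    intro l hl w hw
    have h := hvanish l (by omega) (by omega)
    have hd : ((p + 1 : ℕ) : ℤ) - 1 + l = p + l := by push_cast; ring
    rw [Nat.add_sub_cancel, hd, KoszulBetti.betti_eq_finrank_koszulHomology] at h
    -- `finrank` is also zero for infinite-dimensional spaces; finiteness turns a vanishing Betti
    -- number into vanishing homology.
    have := KoszulBetti.finite_koszulHomology (n := n) 𝓜 p (p + l)
    have hs := Module.finrank_zero_iff.1 h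
    exact (KoszulBetti.koszulClass_eq_zero_iff hw).1 (Subsingleton.elim _ _)
  rw [KoszulBetti.betti_eq_finrank_koszulHomology] at hne
  have hnt := Module.nontrivial_of_finrank_pos (Nat.pos_of_ne_zero hne)
  obtain ⟨c, hc⟩ := exists_ne (0 : KoszulBetti.KoszulHomology n 𝓜 (p + 1) ((p + 1 : ℕ) + t))
  obtain ⟨⟨z, hz⟩, rfl⟩ := Submodule.Quotient.mk_surjective _ c
  obtain ⟨e, he, hdz, hli⟩ := KoszulBetti.exists_linearIndependent_contractions hM hpn
    (q' := ((p + 1 : ℕ) : ℤ) - 1 + t) (by push_cast; ring) (by ring) H hz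
    fun h => hc ((KoszulBetti.koszulClass_eq_zero_iff hz).2 h)
  refine ⟨⟨e, he, z, hz, hdz, hc, hli⟩, ?_⟩
  rw [KoszulBetti.betti_eq_finrank_koszulHomology]
  have := KoszulBetti.finite_koszulHomology (n := n) 𝓜 p (((p + 1 : ℕ) : ℤ) - 1 + t)
  simpa using hli.fintype_card_le_finrank
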